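/- Let $(R,\mathfrak m)$ be a complete Noetherian commutative local ring containing a coefficient field $K$ (a field $K\subseteq R$ such that the composite $K\hookrightarrow R\twoheadrightarrow R/\mathfrak m$ is an isomorphism) which is algebraically closed of characteristic $p>0$, and let $\mathfrak n$ be the nilradical of $R$. For $S=R$ and $S=R/\mathfrak n$, the Frobenius endomorphism $s\mapsto s^p$ of $S$ induces on each local cohomology module $H^i_{\mathfrak m}(S)$ an additive map $F$ with $F(s\eta)=s^pF(\eta)$, and the $F$-stable part of $H^i_{\mathfrak m}(S)$ is the $K$-vector space $$H^i_{\mathfrak m}(S)_{\mathrm{st}}=\bigcap_{e\ge 0}F^e\bigl(H^i_{\mathfrak m}(S)\bigr).$$ Then for every $i\ge 0$, the natural map $H^i_{\mathfrak m}(R)\to H^i_{\mathfrak m}(R/\mathfrak n)$ restricts to an isomorphism of $K$-vector spaces $$H^i_{\mathfrak m}(R)_{\mathrm{st}}\xrightarrow{\ \cong\ }H^i_{\mathfrak m}(R/\mathfrak n)_{\mathrm{st}}.$$ -/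

import Mathlib

universe u v

noncomputable section

namespace CechLC

/-! ### Maps between localizations at one element -/

section Away

variable {A B : Type*} [CommRing A] [CommRing B]

theorem isUnit_away (φ : A →+* B) {a : A} {b : B} (h : ∃ k : ℕ, φ a ∣ b ^ k) :
    IsUnit ((algebraMap B (Localization.Away b)).comp φ a) := by
  obtain ⟨k, hk⟩ := h
  refine isUnit_of_dvd_unit (map_dvd (algebraMap B (Localization.Away b)) hk) ?_
  rw [map_pow]
  exact (IsLocalization.Away.algebraMap_isUnit (S := Localization.Away b) b).pow k

/-- The ring homomorphism `A_a → B_b` induced by `φ : A → B`, where `φ a` divides a power of `b`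
(which says that `φ a` is invertible in `B_b`). -/
def awayMap (φ : A →+* B) {a : A} {b : B} (h : ∃ k : ℕ, φ a ∣ b ^ k) :
    Localization.Away a →+* Localization.Away b :=
  IsLocalization.Away.lift a (isUnit_away φ h)

@[simp]
theorem awayMap_algebraMap (φ : A →+* B) {a : A} {b : B} (h : ∃ k : ℕ, φ a ∣ b ^ k) (r : A) :
    awayMap φ h (algebraMap A _ r) = algebraMap B _ (φ r) :=
  IsLocalization.Away.lift_eq a (isUnit_away φ h) r

theorem awayMap_smul (φ : A →+* B) {a : A} {b : B} (h : ∃ k : ℕ, φ a ∣ b ^ k) (r : A)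
    (z : Localization.Away a) : awayMap φ h (r • z) = φ r • awayMap φ h z := by
  simp [Algebra.smul_def]

theorem awayMap_awayMap {D : Type*} [CommRing D] (φ : A →+* B) (ψ : B →+* D) (χ : A →+* D)
    {a : A} {b : B} {d : D} (h : ∃ k : ℕ, φ a ∣ b ^ k) (h' : ∃ k : ℕ, ψ b ∣ d ^ k)
    (h'' : ∃ k : ℕ, χ a ∣ d ^ k) (hχ : ∀ r, ψ (φ r) = χ r) (z : Localization.Away a) :
    awayMap ψ h' (awayMap φ h z) = awayMap χ h'' z := by
  have : (awayMap ψ h').comp (awayMap φ h) = awayMap χ h'' := by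
    apply IsLocalization.ringHom_ext (Submonoid.powers a)
    ext r
    simp [hχ]
  exact congrArg (fun f => f z) this

end Away

/-! ### The Čech complex and its cohomology -/

section Complex

variable {R : Type u} [CommRing R] {n : ℕ}

/-- The localization of `R` at the product of the elements `x j`, `j ∈ s`. -/
abbrev Loc (x : Fin n → R) (s : Finset (Fin n)) : Type u :=
  Localization.Away (∏ j ∈ s, x j)

theorem prod_dvd (x : Fin n → R) {s t : Finset (Fin n)} (h : s ⊆ t) :
    ∃ k : ℕ, RingHom.id R (∏ j ∈ s, x j) ∣ (∏ j ∈ t, x j) ^ k :=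
  ⟨1, by simpa using Finset.prod_dvd_prod_of_subset s t x h⟩

/-- The canonical map between localizations for `s ⊆ t`. -/
def res (x : Fin n → R) {s t : Finset (Fin n)} (h : s ⊆ t) : Loc x s →+* Loc x t :=
  awayMap (RingHom.id R) (prod_dvd x h)

theorem res_res (x : Fin n → R) {s t w : Finset (Fin n)} (h : s ⊆ t) (h' : t ⊆ w)
    (z : Loc x s) : res x h' (res x h z) = res x (h.trans h') z :=
  awayMap_awayMap _ _ _ _ _ _ (fun _ => rfl) z

/-- Čech cochains of degree `i`: the product of the `R_{x_{j₁} ⋯ x_{jᵢ}}`, `j₁ < ⋯ < jᵢ`. -/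
abbrev Cochain (x : Fin n → R) (i : ℕ) : Type u :=
  ∀ s : {s : Finset (Fin n) // s.card = i}, Loc x s.1

/-- The set `t` with an element removed. -/
def face {i : ℕ} (t : {s : Finset (Fin n) // s.card = i + 1}) (j : t.1) :
    {s : Finset (Fin n) // s.card = i} :=
  ⟨t.1.erase j.1, by rw [Finset.card_erase_of_mem j.2, t.2]; rfl⟩

theorem face_subset {i : ℕ} (t : {s : Finset (Fin n) // s.card = i + 1}) (j : t.1) :
    (face t j).1 ⊆ t.1 := Finset.erase_subset _ _

/-- The position of `j` in `t`. -/
def pos (t : Finset (Fin n)) (j : Fin n) : ℕ := (t.filter (· < j)).card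

/-- The differential of the Čech complex `0 → R → ∏ R_{x_j} → ∏ R_{x_j x_k} → ⋯`. -/
def d (x : Fin n → R) (i : ℕ) : Cochain x i →ₗ[R] Cochain x (i + 1) where
  toFun c t := ∑ j : t.1, (-1) ^ pos t.1 j.1 * res x (face_subset t j) (c (face t j))
  map_add' c c' := by
    funext t
    simp [mul_add, Finset.sum_add_distrib]
  map_smul' r c := by
    funext t
    simp [res, awayMap_smul, Finset.smul_sum]

theorem d_apply (x : Fin n → R) (i : ℕ) (c : Cochain x i) (t) :
    d x i c t = ∑ j : t.1, (-1) ^ pos t.1 j.1 * res x (face_subset t j) (c (face t j)) := rfl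

theorem pos_erase {t : Finset (Fin n)} {j k : Fin n} (hj : j ∈ t) :
    pos (t.erase j) k + (if j < k then 1 else 0) = pos t k := by
  unfold pos
  rw [Finset.filter_erase]
  split_ifs with h
  · exact Finset.card_erase_add_one (Finset.mem_filter.2 ⟨hj, h⟩)
  · rw [Finset.erase_eq_of_notMem (by simp [h]), add_zero]

theorem res_congr (x : Fin n → R) {i : ℕ} (c : Cochain x i) {t : Finset (Fin n)}
    {s s' : {s : Finset (Fin n) // s.card = i}} (e : s = s') (h : s.1 ⊆ t) (h' : s'.1 ⊆ t) :
    res x h (c s) = res x h' (c s') := by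
  subst e; rfl

theorem d_d (x : Fin n → R) (i : ℕ) (c : Cochain x i) : d x (i + 1) (d x i c) = 0 := by
  funext t
  rw [d_apply]
  simp only [d_apply, map_sum, map_mul, map_pow, map_neg, map_one, res_res, Finset.mul_sum,
    Pi.zero_apply]
  rw [Finset.sum_sigma']
  refine Finset.sum_involution
    (fun a _ => ⟨⟨a.2.1, face_subset _ _ a.2.2⟩,
      ⟨a.1.1, Finset.mem_erase.2 ⟨(Finset.mem_erase.1 a.2.2).1.symm, a.1.2⟩⟩⟩) ?_ ?_ ?_ ?_
  · rintro ⟨⟨j, hj⟩, ⟨k, hk⟩⟩ -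
    have hkj : k ≠ j := (Finset.mem_erase.1 hk).1
    have hkt : k ∈ t.1 := (Finset.mem_erase.1 hk).2
    dsimp only
    have hjk : j ∈ (face t ⟨k, hkt⟩).1 := Finset.mem_erase.2 ⟨hkj.symm, hj⟩
    have hf : face (face t ⟨j, hj⟩) ⟨k, hk⟩ = face (face t ⟨k, hkt⟩) ⟨j, hjk⟩ :=
      Subtype.ext Finset.erase_right_comm
    rw [res_congr x c hf _ ((face_subset _ _).trans (face_subset _ _))]
    rw [← mul_assoc, ← mul_assoc, ← add_mul, ← pow_add, ← pow_add]
    have h1 : pos (face t ⟨j, hj⟩).1 k + _ = _ := pos_erase (k := k) hj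
    have h2 : pos (face t ⟨k, hkt⟩).1 j + _ = _ := pos_erase (k := j) hkt
    convert zero_mul _
    rcases lt_or_gt_of_ne hkj with h | h
    · rw [if_neg h.not_gt] at h1
      rw [if_pos h] at h2
      rw [← h1, ← h2]
      ring
    · rw [if_pos h] at h1
      rw [if_neg h.not_gt] at h2
      rw [← h1, ← h2]
      ring
  · rintro ⟨⟨j, hj⟩, ⟨k, hk⟩⟩ - - h
    have hkj : k ≠ j := (Finset.mem_erase.1 hk).1
    exact hkj (congrArg (fun a => a.1.1) h)
  · simp
  · simp

/-- The cocycles of degree `i`. -/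
def cocycles (x : Fin n → R) (i : ℕ) : Submodule R (Cochain x i) := LinearMap.ker (d x i)

/-- The coboundaries of degree `i`. -/
def coboundaries (x : Fin n → R) : ∀ i : ℕ, Submodule R (Cochain x i)
  | 0 => ⊥
  | i + 1 => LinearMap.range (d x i)

theorem coboundaries_le_cocycles (x : Fin n → R) (i : ℕ) : coboundaries x i ≤ cocycles x i := by
  cases i with
  | zero => exact bot_le
  | succ i =>
    rintro _ ⟨c, rfl⟩
    exact d_d x i c

/-- The local cohomology module `H^i_𝔞(R)` of a Noetherian ring `R`, for an ideal `𝔞` with the same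
radical as the ideal generated by the elements `x j`: the `i`-th cohomology module of the Čech
complex of `R` on these elements. -/
def H (x : Fin n → R) (i : ℕ) : Type u :=
  cocycles x i ⧸ (coboundaries x i).submoduleOf (cocycles x i)

instance (x : Fin n → R) (i : ℕ) : AddCommGroup (H x i) :=
  inferInstanceAs (AddCommGroup (cocycles x i ⧸ (coboundaries x i).submoduleOf (cocycles x i)))

instance (x : Fin n → R) (i : ℕ) : Module R (H x i) :=
  inferInstanceAs (Module R (cocycles x i ⧸ (coboundaries x i).submoduleOf (cocycles x i)))

/-- The vector space structure by restriction of scalars along `K → R`. -/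
instance {K : Type v} [Field K] [Algebra K R] (x : Fin n → R) (i : ℕ) : Module K (H x i) :=
  Module.compHom (H x i) (algebraMap K R)

instance {K : Type v} [Field K] [Algebra K R] (x : Fin n → R) (i : ℕ) :
    IsScalarTower K R (H x i) :=
  IsScalarTower.of_algebraMap_smul fun _ _ => rfl

end Complex

/-! ### Functoriality in the ring -/

section Functoriality

variable {R S : Type u} [CommRing R] [CommRing S] {n : ℕ}

theorem prod_map_dvd (φ : R →+* S) {x : Fin n → R} {y : Fin n → S}
    (h : ∃ k : ℕ, ∀ j, φ (x j) ∣ y j ^ k) (s : Finset (Fin n)) :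
    ∃ k : ℕ, φ (∏ j ∈ s, x j) ∣ (∏ j ∈ s, y j) ^ k := by
  obtain ⟨k, hk⟩ := h
  refine ⟨k, ?_⟩
  rw [map_prod, ← Finset.prod_pow]
  exact Finset.prod_dvd_prod_of_dvd _ _ fun j _ => hk j

/-- The map of Čech cochains induced by a ring homomorphism `φ : R → S`, where each `φ (x j)` is
invertible in `S_{y j}`: componentwise the induced map of localizations. -/
def cochainMap (φ : R →+* S) {x : Fin n → R} {y : Fin n → S}
    (h : ∃ k : ℕ, ∀ j, φ (x j) ∣ y j ^ k) (i : ℕ) : Cochain x i →ₛₗ[φ] Cochain y i where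
  toFun c s := awayMap φ (prod_map_dvd φ h s.1) (c s)
  map_add' c c' := by
    funext s
    simp
  map_smul' r c := by
    funext s
    simp [awayMap_smul]

theorem d_cochainMap (φ : R →+* S) {x : Fin n → R} {y : Fin n → S}
    (h : ∃ k : ℕ, ∀ j, φ (x j) ∣ y j ^ k) (i : ℕ) (c : Cochain x i) :
    d y i (cochainMap φ h i c) = cochainMap φ h (i + 1) (d x i c) := by
  funext t
  have key : ∀ {s s' : Finset (Fin n)} (hs : s ⊆ s') (z : Loc x s),
      res y hs (awayMap φ (prod_map_dvd φ h s) z) =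
        awayMap φ (prod_map_dvd φ h s') (res x hs z) := by
    intro s s' hs z
    have hd : ∃ k : ℕ, φ (∏ j ∈ s, x j) ∣ (∏ j ∈ s', y j) ^ k := by
      obtain ⟨k, hk⟩ := prod_map_dvd φ h s
      exact ⟨k, hk.trans (pow_dvd_pow_of_dvd (Finset.prod_dvd_prod_of_subset s s' y hs) k)⟩
    rw [res, res, awayMap_awayMap _ _ φ _ _ hd (fun _ => rfl),
      awayMap_awayMap _ _ φ _ _ hd (fun _ => rfl)]
  simp [d_apply, cochainMap, key]

/-- The map induced on cocycles. -/
def cocyclesMap (φ : R →+* S) {x : Fin n → R} {y : Fin n → S}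
    (h : ∃ k : ℕ, ∀ j, φ (x j) ∣ y j ^ k) (i : ℕ) : cocycles x i →ₛₗ[φ] cocycles y i :=
  ((cochainMap φ h i).comp (cocycles x i).subtype).codRestrict (cocycles y i) fun c => by
    have hc : d x i c.1 = 0 := c.2
    change d y i (cochainMap φ h i c.1) = 0
    rw [d_cochainMap, hc, map_zero]

theorem cocyclesMap_coboundaries (φ : R →+* S) {x : Fin n → R} {y : Fin n → S}
    (h : ∃ k : ℕ, ∀ j, φ (x j) ∣ y j ^ k) (i : ℕ) :
    (coboundaries x i).submoduleOf (cocycles x i) ≤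
      ((coboundaries y i).submoduleOf (cocycles y i)).comap (cocyclesMap φ h i) := by
  rintro ⟨c, hc⟩ hb
  change c ∈ coboundaries x i at hb
  change cochainMap φ h i c ∈ coboundaries y i
  cases i with
  | zero =>
    have : c = 0 := hb
    rw [this, map_zero]
    exact zero_mem _
  | succ i =>
    obtain ⟨b, rfl⟩ := hb
    exact ⟨cochainMap φ h i b, d_cochainMap φ h i b⟩

/-- The map of local cohomology modules induced by a ring homomorphism `φ : R → S`. With
`y j = φ (x j)` it is the natural map `H^i_𝔞(R) → H^i_{𝔞S}(S)`; in general it is that map followed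
by the map given by the localizations of `S`, which identifies `H^i_{𝔞S}(S)` with `H^i_𝔟(S)` when
`φ (x j)` and `y j` divide powers of each other. -/
def mapH (φ : R →+* S) {x : Fin n → R} {y : Fin n → S}
    (h : ∃ k : ℕ, ∀ j, φ (x j) ∣ y j ^ k) (i : ℕ) : H x i →ₛₗ[φ] H y i :=
  Submodule.mapQ _ _ (cocyclesMap φ h i) (cocyclesMap_coboundaries φ h i)

/-- The natural map `H^i_𝔞(R) → H^i_{𝔞S}(S)`. -/
def naturalMap (φ : R →+* S) (x : Fin n → R) (i : ℕ) : H x i →ₛₗ[φ] H (fun j => φ (x j)) i :=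
  mapH φ ⟨1, fun j => by simp⟩ i

/-- The Frobenius action on `H^i_𝔞(R)`: the map induced by the Frobenius endomorphism of `R`,
with `H^i_{𝔞^[p]}(R) = H^i_𝔞(R)`. -/
def frobeniusAction (p : ℕ) [ExpChar R p] (x : Fin n → R) (i : ℕ) :
    H x i →ₛₗ[frobenius R p] H x i :=
  mapH (frobenius R p) ⟨p, fun j => by simp [frobenius_def]⟩ i

end Functoriality

/-! ### The `F`-stable part -/

section Stable

theorem iterate_smul {R : Type u} [CommRing R] (p : ℕ) [ExpChar R p] {M : Type*}
    [AddCommGroup M] [Module R M] (F : M →ₛₗ[frobenius R p] M) (e : ℕ) (r : R) (m : M) :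
    F^[e] (r • m) = r ^ p ^ e • F^[e] m := by
  induction e with
  | zero => simp
  | succ e ih =>
    rw [Function.iterate_succ_apply', Function.iterate_succ_apply', ih, F.map_smulₛₗ,
      frobenius_def, ← pow_mul, pow_succ]

variable (K : Type v) {R : Type u} [Field K] [CommRing R] [Algebra K R] (p : ℕ) [ExpChar K p]
  [PerfectRing K p] [ExpChar R p] {M : Type*} [AddCommGroup M] [Module R M] [Module K M]
  [IsScalarTower K R M]

/-- The `F`-stable part `⋂ₑ Fᵉ(M)` of a module with a Frobenius action, a `K`-vector space. -/
def stablePart (F : M →ₛₗ[frobenius R p] M) : Submodule K M where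
  carrier := ⋂ e : ℕ, Set.range F^[e]
  zero_mem' := Set.mem_iInter.2 fun e => ⟨0, iterate_map_zero F e⟩
  add_mem' := by
    intro a b ha hb
    refine Set.mem_iInter.2 fun e => ?_
    obtain ⟨a', rfl⟩ := Set.mem_iInter.1 ha e
    obtain ⟨b', rfl⟩ := Set.mem_iInter.1 hb e
    exact ⟨a' + b', iterate_map_add F e a' b'⟩
  smul_mem' := by
    intro c a ha
    refine Set.mem_iInter.2 fun e => ?_
    obtain ⟨a', rfl⟩ := Set.mem_iInter.1 ha e
    obtain ⟨b, rfl⟩ := (bijective_iterateFrobenius K p e).2 c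
    refine ⟨b • a', ?_⟩
    rw [← algebraMap_smul R b a', iterate_smul, ← map_pow, algebraMap_smul, iterateFrobenius_def]

end Stable

/-- The quotient by the nilradical has the same prime characteristic. -/
instance charP_quotient_nilradical {R : Type u} [CommRing R] [Nontrivial R] (p : ℕ)
    [Fact p.Prime] [CharP R p] : CharP (R ⧸ nilradical R) p := by
  have : Nontrivial (R ⧸ nilradical R) := by
    refine Ideal.Quotient.nontrivial_iff.2 fun h => ?_
    have : IsNilpotent (1 : R) := mem_nilradical.1 (h ▸ Submodule.mem_top)
    exact not_isNilpotent_one this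
  have h0 : ((p : ℕ) : R ⧸ nilradical R) = 0 := by
    rw [← map_natCast (Ideal.Quotient.mk (nilradical R)), CharP.cast_eq_zero, map_zero]
  obtain ⟨q, hq⟩ := CharP.exists (R ⧸ nilradical R)
  rcases (Nat.dvd_prime (Fact.out : p.Prime)).1 ((CharP.cast_eq_zero_iff _ q p).1 h0) with h | h
  · exact absurd h (CharP.char_ne_one (R ⧸ nilradical R) q)
  · exact h ▸ hq

end CechLC

end

set_option linter.unusedSectionVars false

noncomputable section

namespace CechLC

/-! ### Ideals times finite products, and a complete version of Nakayama's lemma -/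

section Pi

variable {R : Type*} [CommRing R]

/-! Write `q` for the projection modulo the nilradical, `τ` for the map it induces on cohomology,
and `F`, `G` for the Frobenius actions of source and target. The nilradical is nilpotent, so some
iterate of Frobenius kills it and factors as `ψ ∘ q`. Then `ψ` induces a map `ρ` backwards, with `ρ
τ = F^e` and `τ ρ = G^e`, and `τ`, `ρ` commute with the actions. So it suffices that `F^e` is
injective on stable elements and that `G^e` maps stable elements onto stable elements. Both follow
once a single iterate kills all nilpotent elements; such a bound for `F` passes to `G` through `ρ`
and `τ`.

That bound is the Hartshorne–Speiser–Lyubeznik theorem, `exists_iterate_eq_zero`, proved for modules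
that are torsion for the maximal ideal and have a finitely generated dual. Duality is with values in
`Hom_K(R, K)`, so that dual elements are `K`-linear functionals. The spans of the images `F^e` of
the nilpotent elements decrease and, by duality, stabilize at some `V` spanned by `F(V)`.
`eq_zero_of_nilpotent` shows `V = 0`: Artin–Rees, applied to the transpose of `F`, shows that a
suitable socle layer is spanned by the image of any iterate of `F`, while finite length makes one
iterate vanish on that layer.

The hypotheses on local cohomology are `isMTorsion_H` and `isCofinite_H`. The first uses the
contraction of the Čech complex after inverting one `x j`. The second is an induction on the degree
with coefficients in all finitely generated modules, reduced by prime filtrations to a regular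
element or the residue field. -/

theorem mem_smul_top_pi {ι : Type*} [Finite ι] {M : Type*} [AddCommGroup M] [Module R M]
    (I : Ideal R) (f : ι → M) :
    f ∈ (I • ⊤ : Submodule R (ι → M)) ↔ ∀ i, f i ∈ (I • ⊤ : Submodule R M) := by
  classical
  have := Fintype.ofFinite ι
  constructor
  · intro h i
    have := Submodule.mem_map_of_mem (f := LinearMap.proj (φ := fun _ => M) i) h
    rw [Submodule.map_smul''] at this
    exact Submodule.smul_mono le_rfl le_top this
  · intro h
    rw [← Finset.univ_sum_single f]
    refine Submodule.sum_mem _ fun i _ => ?_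
    have := Submodule.mem_map_of_mem (f := LinearMap.single R (fun _ : ι => M) i) (h i)
    rw [Submodule.map_smul''] at this
    exact Submodule.smul_mono le_rfl le_top this

theorem isPrecomplete_pi {ι : Type*} [Finite ι] (I : Ideal R) [IsPrecomplete I R] :
    IsPrecomplete I (ι → R) := by
  refine ⟨fun f hf => ?_⟩
  have h (i : ι) : ∃ L : R, ∀ n, f n i ≡ L [SMOD (I ^ n • ⊤ : Submodule R R)] := by
    refine IsPrecomplete.prec' (fun n => f n i) fun {m n} hmn => ?_
    have := hf hmn
    rw [SModEq.sub_mem, mem_smul_top_pi] at this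
    rw [SModEq.sub_mem]
    exact this i
  choose L hL using h
  refine ⟨L, fun n => ?_⟩
  rw [SModEq.sub_mem, mem_smul_top_pi]
  intro i
  exact SModEq.sub_mem.1 (hL i n)

/-- Generators of `N` define a map from a finite free module that is onto modulo `I`. Completeness
of the source and separatedness of `Q` make it onto by successive approximation, without assuming
`Q` finitely generated. -/
theorem finite_of_isHausdorff (I : Ideal R) [IsPrecomplete I R] {Q : Type*} [AddCommGroup Q]
    [Module R Q] [IsHausdorff I Q] (N : Submodule R Q) (hN : N.FG) (h : N ⊔ I • ⊤ = ⊤) :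
    Module.Finite R Q := by
  obtain ⟨n, g, hg⟩ := Submodule.fg_iff_exists_fin_generating_family.1 hN
  have := isPrecomplete_pi (ι := Fin n) I
  refine Module.Finite.of_surjective (Fintype.linearCombination R g)
    (surjective_of_mkQ_comp_surjective (I := I) ?_)
  rw [← LinearMap.range_eq_top, LinearMap.range_comp, Fintype.range_linearCombination, hg,
    Submodule.map_mkQ_eq_top, sup_comm, h]

end Pi

/-! ### The dual of a module over an algebra over a field -/

section Coind

variable (K : Type v) (R : Type u) [Field K] [CommRing R] [Algebra K R]

/-- The coinduced `R`-module `Hom_K(R, K)`, so that `Hom_R(M, Hom_K(R, K)) = Hom_K(M, K)`. -/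
def Coind : Type max u v := R →ₗ[K] K

instance : AddCommGroup (Coind K R) := inferInstanceAs (AddCommGroup (R →ₗ[K] K))

variable {K R}

/-- The underlying linear map. -/
def Coind.toLin (f : Coind K R) : R →ₗ[K] K := f

theorem Coind.ext {f g : Coind K R} (h : ∀ r : R, f.toLin r = g.toLin r) : f = g :=
  LinearMap.ext h

/-- The value at `r`. -/
def Coind.eval (r : R) : Coind K R →+ K where
  toFun f := f.toLin r
  map_zero' := rfl
  map_add' _ _ := rfl

instance : Module R (Coind K R) where
  smul r f := f.toLin.comp (LinearMap.mulLeft K r)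
  one_smul f := Coind.ext fun s => congrArg f.toLin (one_mul s)
  mul_smul r r' f := Coind.ext fun s => congrArg f.toLin (by
    change r * r' * s = r' * (r * s); ring)
  smul_zero _ := rfl
  smul_add _ _ _ := rfl
  add_smul r r' f := Coind.ext fun s => by
    change f.toLin ((r + r') * s) = f.toLin (r * s) + f.toLin (r' * s)
    rw [add_mul, map_add]
  zero_smul f := Coind.ext fun s => by
    change f.toLin (0 * s) = 0
    rw [zero_mul, map_zero]

theorem Coind.eval_smul (r s : R) (f : Coind K R) : eval s (r • f) = eval (r * s) f := rfl

variable (K R) in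
/-- The dual of an `R`-module with respect to `Hom_K(R, K)`. -/
abbrev CoDual (M : Type*) [AddCommGroup M] [Module R M] := M →ₗ[R] Coind K R

variable {M N : Type*} [AddCommGroup M] [Module R M] [AddCommGroup N] [Module R N]

/-- The `K`-valued functional that corresponds to an element of the dual. -/
def functional (φ : CoDual K R M) : M →+ K := (Coind.eval 1).comp φ.toAddMonoidHom

theorem eval_apply (φ : CoDual K R M) (z : M) (r : R) :
    Coind.eval r (φ z) = functional φ (r • z) := by
  change _ = Coind.eval 1 (φ (r • z))
  rw [map_smul, Coind.eval_smul, mul_one]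

theorem functional_smul (r : R) (φ : CoDual K R M) (z : M) :
    functional (r • φ) z = functional φ (r • z) := by
  change Coind.eval 1 (r • φ z) = Coind.eval 1 (φ (r • z))
  rw [LinearMap.map_smul]

theorem functional_add (φ ψ : CoDual K R M) (z : M) :
    functional (φ + ψ) z = functional φ z + functional ψ z := rfl

theorem functional_sub (φ ψ : CoDual K R M) (z : M) :
    functional (φ - ψ) z = functional φ z - functional ψ z := rfl

theorem functional_algebraMap_smul (φ : CoDual K R M) (k : K) (z : M) :
    functional φ (algebraMap K R k • z) = k * functional φ z := by
  rw [← eval_apply]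
  change (φ z).toLin (algebraMap K R k) = k * (φ z).toLin 1
  rw [Algebra.algebraMap_eq_smul_one, map_smul, smul_eq_mul]

theorem CoDual.ext {φ ψ : CoDual K R M} (h : ∀ z, functional φ z = functional ψ z) : φ = ψ :=
  LinearMap.ext fun z => Coind.ext fun r => by
    have := h (r • z)
    rwa [← eval_apply, ← eval_apply] at this

/-- The element of the dual that corresponds to a `K`-linear functional. -/
def ofFunctional (n : M →+ K) (hn : ∀ k z, n (algebraMap K R k • z) = k * n z) : CoDual K R M where
  toFun z :=
    ({ toFun := fun r => n (r • z)
       map_add' := fun r s => by rw [add_smul, map_add]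
       map_smul' := fun k r => by
        rw [Algebra.smul_def, mul_smul, hn, RingHom.id_apply, smul_eq_mul] } : R →ₗ[K] K)
  map_add' z w := Coind.ext fun r => by
    change n (r • (z + w)) = n (r • z) + n (r • w)
    rw [smul_add, map_add]
  map_smul' s z := Coind.ext fun r => by
    change n (r • s • z) = n ((s * r) • z)
    rw [← mul_smul, mul_comm]

@[simp]
theorem functional_ofFunctional (n : M →+ K) (hn : ∀ k z, n (algebraMap K R k • z) = k * n z)
    (z : M) : functional (ofFunctional n hn) z = n z := by
  change n ((1 : R) • z) = n z
  rw [one_smul]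

/-- This is the injectivity of `Coind K R`: by adjunction it amounts to extending a `K`-linear
functional from the image of `f`, which is possible over a field. -/
theorem exists_coDual_extend (f : M →ₗ[R] N) (φ : CoDual K R M) (h : ∀ z, f z = 0 → φ z = 0) :
    ∃ ψ : CoDual K R N, ∀ z, ψ (f z) = φ z := by
  let _ := Module.compHom M (algebraMap K R)
  let _ := Module.compHom N (algebraMap K R)
  let f' : M →ₗ[K] N :=
    { f with map_smul' := fun k z => map_smul f (algebraMap K R k) z }
  let n : M →ₗ[K] K :=
    { functional φ with map_smul' := fun k z => functional_algebraMap_smul φ k z }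
  have hn : n ∈ LinearMap.range f'.dualMap := by
    rw [LinearMap.range_dualMap_eq_dualAnnihilator_ker, Submodule.mem_dualAnnihilator]
    intro z hz
    change Coind.eval 1 (φ z) = 0
    rw [h z hz, map_zero]
  obtain ⟨n', hn'⟩ := hn
  refine ⟨ofFunctional n'.toAddMonoidHom fun k z => map_smul n' k z, fun z => ?_⟩
  refine Coind.ext fun r => ?_
  change n' (r • f z) = Coind.eval r (φ z)
  rw [eval_apply, ← map_smul]
  exact congrArg (fun g : Module.Dual K M => g (r • z)) hn'

theorem exists_coDual_separating (N : Submodule R M) {z : M} (hz : z ∉ N) :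
    ∃ φ : CoDual K R M, (∀ w ∈ N, functional φ w = 0) ∧ functional φ z ≠ 0 := by
  let _ := Module.compHom M (algebraMap K R)
  let N' : Submodule K M := { N with smul_mem' := fun k w hw => N.smul_mem (algebraMap K R k) hw }
  obtain ⟨f, hf, hN⟩ := Submodule.exists_le_ker_of_notMem (p := N') hz
  refine ⟨ofFunctional f.toAddMonoidHom fun k z => map_smul f k z, fun w hw => ?_, ?_⟩
  · exact (functional_ofFunctional _ _ w).trans (hN hw)
  · exact fun h => hf ((functional_ofFunctional _ _ z).symm.trans h)

/-! ### Cofinite modules -/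

variable (K R) in
/-- The dual of the module is finitely generated. -/
def IsCofinite (M : Type*) [AddCommGroup M] [Module R M] : Prop := Module.Finite R (CoDual K R M)

section Noetherian

variable [IsNoetherianRing R] {P : Type*} [AddCommGroup P] [Module R P]

/-- Here `P` is a quotient of the image of `f`, hence a subquotient of `M`. Dually, `CoDual K R P`
embeds into the range of `F`, a quotient of the Noetherian module `CoDual K R M`. -/
theorem IsCofinite.of_ker_le (hM : IsCofinite K R M) (f : N →ₗ[R] M) (g : N →ₗ[R] P)
    (hg : Function.Surjective g) (h : ∀ z, f z = 0 → g z = 0) : IsCofinite K R P := by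
  have : Module.Finite R (CoDual K R M) := hM
  let F : CoDual K R M →ₗ[R] CoDual K R N := LinearMap.lcomp R (Coind K R) f
  let G : CoDual K R P →ₗ[R] CoDual K R N := LinearMap.lcomp R (Coind K R) g
  have hGF : ∀ φ, G φ ∈ LinearMap.range F := by
    intro φ
    obtain ⟨ψ, hψ⟩ := exists_coDual_extend f (G φ) fun z hz => by
      change φ (g z) = 0
      rw [h z hz, map_zero]
    exact ⟨ψ, LinearMap.ext hψ⟩
  refine Module.Finite.of_injective (G.codRestrict (LinearMap.range F) hGF) fun φ ψ hφ => ?_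
  refine LinearMap.ext fun z => ?_
  obtain ⟨w, rfl⟩ := hg z
  exact LinearMap.congr_fun (congrArg Subtype.val hφ) w

theorem IsCofinite.of_injective (hM : IsCofinite K R M) (f : N →ₗ[R] M)
    (hf : Function.Injective f) : IsCofinite K R N :=
  hM.of_ker_le f LinearMap.id Function.surjective_id fun z hz => hf (by simpa using hz)

theorem IsCofinite.of_surjective (hM : IsCofinite K R M) (f : M →ₗ[R] N)
    (hf : Function.Surjective f) : IsCofinite K R N :=
  hM.of_ker_le LinearMap.id f hf fun z hz => by
    rw [LinearMap.id_apply] at hz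
    rw [hz, map_zero]

/-- Dualizing preserves exactness at the middle term, and an extension of Noetherian modules is
Noetherian. -/
theorem IsCofinite.of_exact (hM : IsCofinite K R M) (hP : IsCofinite K R P) (f : M →ₗ[R] N)
    (g : N →ₗ[R] P) (h : ∀ z, g z = 0 → ∃ w, f w = z) : IsCofinite K R N := by
  have : Module.Finite R (CoDual K R M) := hM
  have : Module.Finite R (CoDual K R P) := hP
  let F : CoDual K R N →ₗ[R] CoDual K R M := LinearMap.lcomp R (Coind K R) f
  let G : CoDual K R P →ₗ[R] CoDual K R N := LinearMap.lcomp R (Coind K R) g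
  have hle : LinearMap.ker F ≤ LinearMap.range G := by
    intro φ hφ
    obtain ⟨ψ, hψ⟩ := exists_coDual_extend g φ fun z hz => by
      obtain ⟨w, rfl⟩ := h z hz
      exact LinearMap.congr_fun hφ w
    exact ⟨ψ, LinearMap.ext hψ⟩
  have h1 : IsNoetherian R (LinearMap.ker F) := isNoetherian_of_le hle
  have : IsNoetherian R (CoDual K R N) :=
    isNoetherian_of_range_eq_ker (LinearMap.ker F).subtype F (by simp)
  exact inferInstanceAs (Module.Finite R (CoDual K R N))

theorem isCofinite_of_subsingleton [Subsingleton M] : IsCofinite K R M := by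
  have : Subsingleton (CoDual K R M) := inferInstance
  exact inferInstanceAs (Module.Finite R (CoDual K R M))

variable [IsLocalRing R]

open IsLocalRing

theorem isCofinite_residue (hK : Function.Surjective ((residue R).comp (algebraMap K R))) :
    IsCofinite K R (R ⧸ maximalIdeal R) := by
  have hKr : ∀ z : R ⧸ maximalIdeal R, ∃ k : K,
      algebraMap K R k • (Submodule.Quotient.mk 1 : R ⧸ maximalIdeal R) = z := by
    intro z
    obtain ⟨k, hk⟩ := hK z
    refine ⟨k, ?_⟩
    rw [← hk, ← Submodule.Quotient.mk_smul, smul_eq_mul, mul_one]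
    rfl
  -- The residue field is spanned over `K` by the class of 1, so a functional is determined by its
  -- value there. If all these values vanish, the dual is zero and there is nothing to generate.
  by_cases h : ∃ φ : CoDual K R (R ⧸ maximalIdeal R),
      functional φ (Submodule.Quotient.mk 1) ≠ 0
  · obtain ⟨φ, hφ⟩ := h
    refine ⟨⟨{φ}, eq_top_iff.2 fun ψ _ => ?_⟩⟩
    rw [Finset.coe_singleton, Submodule.mem_span_singleton]
    set a := functional φ (Submodule.Quotient.mk 1)
    refine ⟨algebraMap K R (functional ψ (Submodule.Quotient.mk 1) / a), CoDual.ext fun z => ?_⟩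
    obtain ⟨k, rfl⟩ := hKr z
    rw [functional_smul, functional_algebraMap_smul, functional_algebraMap_smul,
      functional_algebraMap_smul]
    change _ * (k * a) = _
    field_simp
  · push Not at h
    have : Subsingleton (CoDual K R (R ⧸ maximalIdeal R)) := by
      refine ⟨fun φ ψ => CoDual.ext fun z => ?_⟩
      obtain ⟨k, rfl⟩ := hKr z
      rw [functional_algebraMap_smul, functional_algebraMap_smul, h, h]
    exact inferInstanceAs (Module.Finite R (CoDual K R (R ⧸ maximalIdeal R)))

variable (R) in
/-- Every element is killed by a power of the maximal ideal. -/
def IsMTorsion (M : Type*) [AddCommGroup M] [Module R M] : Prop :=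
  ∀ z : M, ∃ k : ℕ, ∀ r ∈ maximalIdeal R ^ k, r • z = 0

theorem IsMTorsion.submodule (hM : IsMTorsion R M) (N : Submodule R M) : IsMTorsion R N := by
  intro z
  obtain ⟨k, hk⟩ := hM z
  exact ⟨k, fun r hr => Subtype.ext (hk r hr)⟩

theorem functional_eq_zero_of_mem_smul {I : Ideal R} {φ : CoDual K R M}
    (hφ : φ ∈ (I • ⊤ : Submodule R (CoDual K R M))) {z : M} (hz : ∀ r ∈ I, r • z = 0) :
    functional φ z = 0 := by
  induction hφ using Submodule.smul_induction_on' with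
  | smul r hr ψ _ => rw [functional_smul, hz r hr, map_zero]
  | add φ _ ψ _ h1 h2 => rw [functional_add, h1, h2, add_zero]

/-- The elements killed by `I` form the kernel of `z ↦ (g i • z)`, for generators `g i` of `I`. A
functional vanishing on them extends along this map, and the components of the extension write it as
`∑ g i • ψ i`. -/
theorem mem_smul_of_functional_eq_zero (I : Ideal R) {φ : CoDual K R M}
    (h : ∀ z : M, (∀ r ∈ I, r • z = 0) → functional φ z = 0) :
    φ ∈ (I • ⊤ : Submodule R (CoDual K R M)) := by
  classical
  obtain ⟨n, g, hg⟩ := Submodule.fg_iff_exists_fin_generating_family.1 (IsNoetherian.noetherian I)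
  let f : M →ₗ[R] (Fin n → M) := LinearMap.pi fun i => LinearMap.lsmul R M (g i)
  obtain ⟨ψ, hψ⟩ := exists_coDual_extend f φ fun z hz => by
    have hz' : ∀ r ∈ I, r • z = 0 := by
      intro r hr
      rw [← hg] at hr
      induction hr using Submodule.span_induction with
      | mem r hr =>
        obtain ⟨i, rfl⟩ := hr
        exact congrFun hz i
      | zero => rw [zero_smul]
      | add r s _ _ h1 h2 => rw [add_smul, h1, h2, add_zero]
      | smul a r _ h1 => rw [smul_eq_mul, mul_smul, h1, smul_zero]
    refine Coind.ext fun r => ?_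
    change Coind.eval r (φ z) = 0
    rw [eval_apply]
    refine h _ fun s hs => ?_
    rw [← mul_smul, mul_comm, mul_smul, hz' s hs, smul_zero]
  have : φ = ∑ i, g i • (ψ.comp (LinearMap.single R (fun _ => M) i)) := by
    refine LinearMap.ext fun z => ?_
    rw [← hψ, ← Finset.univ_sum_single (f z), map_sum, LinearMap.sum_apply]
    refine Finset.sum_congr rfl fun i _ => ?_
    rw [LinearMap.smul_apply, ← map_smul, LinearMap.comp_apply, map_smul]
    simp [f, Pi.single_smul]
  rw [this]
  refine Submodule.sum_mem _ fun i _ => Submodule.smul_mem_smul ?_ trivial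
  rw [← hg]
  exact Submodule.subset_span ⟨i, rfl⟩

/-- An element of every `𝔪 ^ k • ⊤` vanishes on everything killed by some `𝔪 ^ k`, which is all of
`M`. -/
theorem IsMTorsion.isHausdorff (hM : IsMTorsion R M) :
    IsHausdorff (maximalIdeal R) (CoDual K R M) := by
  refine ⟨fun φ hφ => CoDual.ext fun z => ?_⟩
  obtain ⟨k, hk⟩ := hM z
  rw [functional_eq_zero_of_mem_smul (SModEq.zero.1 (hφ k)) hk]
  rfl

/-- Restriction to the `y`-torsion is surjective on duals, with kernel `y` times the dual of `M`. So
the dual of `M` is finitely generated modulo the maximal ideal, and it is separated since `M` is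
torsion; Nakayama over the complete ring finishes. -/
theorem IsMTorsion.isCofinite [IsAdicComplete (maximalIdeal R) R] (hM : IsMTorsion R M) {y : R}
    (hy : y ∈ maximalIdeal R) (h : IsCofinite K R (LinearMap.ker (LinearMap.lsmul R M y))) :
    IsCofinite K R M := by
  have := hM.isHausdorff (K := K)
  set S := LinearMap.ker (LinearMap.lsmul R M y)
  have : Module.Finite R (CoDual K R S) := h
  let F : CoDual K R M →ₗ[R] CoDual K R S := LinearMap.lcomp R (Coind K R) S.subtype
  have hF : Function.Surjective F := fun φ => by
    obtain ⟨ψ, hψ⟩ := exists_coDual_extend S.subtype φ fun z hz => by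
      rw [show z = 0 from Subtype.ext hz, map_zero]
    exact ⟨ψ, LinearMap.ext hψ⟩
  obtain ⟨n, g, hg⟩ := Submodule.fg_iff_exists_fin_generating_family.1
    (Module.Finite.fg_top (R := R) (M := CoDual K R S))
  choose G hG using fun i => hF (g i)
  refine finite_of_isHausdorff (maximalIdeal R) (Submodule.span R (Set.range G))
    (Submodule.fg_span (Set.finite_range G)) (eq_top_iff.2 fun φ _ => ?_)
  have h1 : F φ ∈ Submodule.map F (Submodule.span R (Set.range G)) := by
    rw [Submodule.map_span, ← Set.range_comp, show F ∘ G = g from funext hG, hg]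
    trivial
  obtain ⟨ψ, hψ, hψF⟩ := h1
  refine Submodule.mem_sup.2 ⟨ψ, hψ, φ - ψ, ?_, by abel⟩
  refine Submodule.smul_mono (I := Ideal.span {y}) (by simpa [Ideal.span_le] using hy) le_rfl ?_
  refine mem_smul_of_functional_eq_zero _ fun z hz => ?_
  have hzS : z ∈ S := hz y (Ideal.mem_span_singleton_self y)
  rw [functional_sub, sub_eq_zero]
  exact congrArg (Coind.eval 1) (LinearMap.congr_fun hψF ⟨z, hzS⟩).symm

end Noetherian

end Coind

open IsLocalRing

/-! ### The Hartshorne–Speiser–Lyubeznik theorem -/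

section FiniteSpan

variable {K : Type v} {R : Type u} [Field K] [CommRing R] [Algebra K R] [IsNoetherianRing R]
  [IsLocalRing R]

/-- Modulo `𝔪 ^ (N + 1)`, generators of `𝔪 ^ N` need coefficients only modulo `𝔪`, that is, in `K`.
-/
theorem exists_fg_sup_pow (hK : Function.Surjective ((residue R).comp (algebraMap K R))) (N : ℕ) :
    ∃ S : Submodule K R, S.FG ∧ S ⊔ (maximalIdeal R ^ N).restrictScalars K = ⊤ := by
  induction N with
  | zero => exact ⟨⊥, Submodule.fg_bot, by simp⟩
  | succ N ih =>
    obtain ⟨S, hS, hSN⟩ := ih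
    obtain ⟨G, hG⟩ := IsNoetherian.noetherian (maximalIdeal R ^ N)
    refine ⟨S ⊔ Submodule.span K (G : Set R), hS.sup (Submodule.fg_span G.finite_toSet), ?_⟩
    rw [eq_top_iff, ← hSN, sup_assoc]
    refine sup_le_sup le_rfl fun z hz => ?_
    change z ∈ maximalIdeal R ^ N at hz
    rw [← hG] at hz
    obtain ⟨n, f, g, rfl⟩ := Submodule.mem_span_set'.1 hz
    refine Submodule.sum_mem _ fun i _ => ?_
    obtain ⟨k, hk⟩ := hK (residue R (f i))
    have h1 : f i - algebraMap K R k ∈ maximalIdeal R := by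
      rw [← residue_eq_zero_iff, map_sub, ← hk]
      exact sub_self _
    refine Submodule.mem_sup.2 ⟨k • (g i : R), Submodule.smul_mem _ _ (Submodule.subset_span (g i).2),
      (f i - algebraMap K R k) * g i, ?_, ?_⟩
    · change _ ∈ maximalIdeal R ^ (N + 1)
      rw [pow_succ']
      refine Ideal.mul_mem_mul h1 ?_
      rw [← hG]
      exact Submodule.subset_span (g i).2
    · rw [Algebra.smul_def, smul_eq_mul]
      ring

/-- An approximate F-finiteness of `R`, with generators independent of the precision `N`. They come
from a finite-dimensional `K`-space that fills `R` modulo the Frobenius image of `𝔪`; coefficients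
in `K` are `p`-th powers. -/
theorem exists_frobenius_span (p : ℕ) [ExpChar K p] [PerfectRing K p] [ExpChar R p]
    (hK : Function.Surjective ((residue R).comp (algebraMap K R))) :
    ∃ (n : ℕ) (g : Fin n → R), ∀ (N : ℕ) (r : R), ∃ s : Fin n → R,
      r - ∑ i, frobenius R p (s i) * g i ∈ (maximalIdeal R ^ N).map (frobenius R p) := by
  set 𝔪 := maximalIdeal R
  obtain ⟨L, hL⟩ : ∃ L, 𝔪 ^ L ≤ 𝔪.map (frobenius R p) := by
    refine Ideal.exists_pow_le_of_le_radical_of_fg (fun r hr => ?_) (IsNoetherian.noetherian _)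
    exact ⟨p, Ideal.mem_map_of_mem (frobenius R p) hr⟩
  obtain ⟨S, hS, hSL⟩ := exists_fg_sup_pow hK L
  obtain ⟨n, g, rfl⟩ := Submodule.fg_iff_exists_fin_generating_family.1 hS
  let Λ : (Fin n → R) →+ R :=
    { toFun := fun s => ∑ i, frobenius R p (s i) * g i
      map_zero' := by simp
      map_add' := fun s t => by simp [add_mul, Finset.sum_add_distrib] }
  have hΛ (a : R) (s : Fin n → R) : frobenius R p a * Λ s = Λ (a • s) := by
    simp [Λ, Finset.mul_sum, mul_assoc]
  have h1 (r : R) : ∃ s, r - Λ s ∈ 𝔪.map (frobenius R p) := by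
    obtain ⟨t, ht, q, hq, rfl⟩ := Submodule.mem_sup.1 (hSL.ge (Submodule.mem_top (x := r)))
    obtain ⟨c, rfl⟩ := (Submodule.mem_span_range_iff_exists_fun K).1 ht
    refine ⟨fun i => algebraMap K R ((frobeniusEquiv K p).symm (c i)), ?_⟩
    have : Λ (fun i => algebraMap K R ((frobeniusEquiv K p).symm (c i))) = ∑ i, c i • g i := by
      change ∑ i, frobenius R p (algebraMap K R ((frobeniusEquiv K p).symm (c i))) * g i = _
      refine Finset.sum_congr rfl fun i _ => ?_
      rw [← RingHom.map_frobenius, frobenius_apply_frobeniusEquiv_symm, Algebra.smul_def]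
    rw [this, add_sub_cancel_left]
    exact hL hq
  refine ⟨n, g, fun N => ?_⟩
  change ∀ r, ∃ s, r - Λ s ∈ _
  induction N with
  | zero =>
    intro r
    refine ⟨0, ?_⟩
    rw [pow_zero, Ideal.one_eq_top, Ideal.map_top]
    trivial
  | succ N ih =>
    intro r
    obtain ⟨s, hs⟩ := ih r
    obtain ⟨l, f, a, ha⟩ := Submodule.mem_span_set'.1 hs
    have ha' (i : Fin l) : ∃ b ∈ 𝔪 ^ N, frobenius R p b = a i := (a i).2
    choose b hb hba using ha'
    choose t ht using fun i => h1 (f i)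
    -- The remainder is a combination of `p`-th powers `b i ^ p` with `b i ∈ 𝔪 ^ N`. Approximating
    -- its coefficients to first order gains one more factor.
    refine ⟨s + ∑ i, b i • t i, ?_⟩
    have : r - Λ (s + ∑ i, b i • t i) = ∑ i, (f i - Λ (t i)) * frobenius R p (b i) := by
      rw [map_add, ← sub_sub, ← ha, map_sum, ← Finset.sum_sub_distrib]
      refine Finset.sum_congr rfl fun i _ => ?_
      rw [← hΛ, hba, smul_eq_mul]
      ring
    rw [this, pow_succ', Ideal.map_mul]
    exact Submodule.sum_mem _ fun i _ =>
      Ideal.mul_mem_mul (ht i) (Ideal.mem_map_of_mem (frobenius R p) (hb i))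

end FiniteSpan

/-! ### Socle layers and Frobenius actions on cofinite torsion modules -/

section HSL

variable {K : Type v} {R : Type u} [Field K] [CommRing R] [Algebra K R] [IsNoetherianRing R]
  [IsLocalRing R] {M : Type*} [AddCommGroup M] [Module R M]

variable (R M) in
/-- The elements killed by the `k`-th power of the maximal ideal. -/
def socle (k : ℕ) : Submodule R M := Submodule.torsionBySet R M (maximalIdeal R ^ k : Ideal R)

theorem mem_socle {k : ℕ} {z : M} : z ∈ socle R M k ↔ ∀ r ∈ maximalIdeal R ^ k, r • z = 0 := by
  simp [socle, Submodule.mem_torsionBySet_iff]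

theorem eq_zero_of_socle_eq_bot (hM : IsMTorsion R M) {k : ℕ} (hk : k ≠ 0)
    (h : socle R M k = ⊥) (z : M) : z = 0 := by
  obtain ⟨j, hj⟩ := hM z
  induction j generalizing z with
  | zero => simpa using hj 1
  | succ j ih =>
    have h1 : ∀ a ∈ maximalIdeal R, a • z = 0 := fun a ha => ih _ fun r hr => by
      rw [← mul_smul]
      exact hj _ (by rw [pow_succ]; exact Ideal.mul_mem_mul hr ha)
    rw [← Submodule.mem_bot R, ← h, mem_socle]
    exact fun r hr => h1 r (Ideal.pow_le_self hk hr)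

/-- The socle layer is finite-dimensional over `K`. On it `R` acts through the span of finitely many
`s i`, so the values of the generators `q j` of the dual on the `s i • z` determine `z`. -/
theorem exists_stable_of_socle
    (hK : Function.Surjective ((residue R).comp (algebraMap K R))) (hM : IsCofinite K R M) (k : ℕ)
    (V : ℕ →o Submodule R M) : ∃ e, ∀ e' ≥ e, V e ⊓ socle R M k = V e' ⊓ socle R M k := by
  let _ := Module.compHom M (algebraMap K R)
  have : IsScalarTower K R M := IsScalarTower.of_algebraMap_smul fun _ _ => rfl
  obtain ⟨S, hS, hSk⟩ := exists_fg_sup_pow hK k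
  obtain ⟨a, s, rfl⟩ := Submodule.fg_iff_exists_fin_generating_family.1 hS
  have : Module.Finite R (CoDual K R M) := hM
  obtain ⟨b, q, hq⟩ := Submodule.fg_iff_exists_fin_generating_family.1
    (Module.Finite.fg_top (R := R) (M := CoDual K R M))
  let f : socle R M k →ₗ[K] (Fin a × Fin b → K) :=
    { toFun := fun z ij => functional (q ij.2) (s ij.1 • z.1)
      map_add' := fun z w => by
        funext ij
        simp
      map_smul' := fun c z => by
        funext ij
        change functional (q ij.2) (s ij.1 • algebraMap K R c • z.1) = _
        rw [smul_comm, functional_algebraMap_smul]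
        rfl }
  have hf : Function.Injective f := by
    rw [← LinearMap.ker_eq_bot, LinearMap.ker_eq_bot']
    intro z hz
    have h1 (i : Fin b) (r : R) : functional (q i) (r • z.1) = 0 := by
      obtain ⟨t, ht, m, hm, rfl⟩ := Submodule.mem_sup.1 (hSk.ge (Submodule.mem_top (x := r)))
      obtain ⟨c, rfl⟩ := (Submodule.mem_span_range_iff_exists_fun K).1 ht
      rw [add_smul, map_add, mem_socle.1 z.2 m hm, map_zero, add_zero, Finset.sum_smul, map_sum]
      refine Finset.sum_eq_zero fun j _ => ?_
      rw [Algebra.smul_def, mul_smul, functional_algebraMap_smul,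
        show functional (q i) (s j • z.1) = 0 from congrFun hz (j, i), mul_zero]
    by_contra hz0
    obtain ⟨φ, -, hφ⟩ := exists_coDual_separating (K := K) (⊥ : Submodule R M) (z := z.1)
      (fun h => hz0 (Subtype.ext h))
    refine hφ ?_
    obtain ⟨c, rfl⟩ := (Submodule.mem_span_range_iff_exists_fun R).1
      (hq.ge (Submodule.mem_top (x := φ)))
    have h2 (t : Finset (Fin b)) : functional (∑ i ∈ t, c i • q i) z.1 = 0 := by
      induction t using Finset.induction_on with
      | empty => simp [functional]
      | insert i t hi ih =>
        rw [Finset.sum_insert hi, functional_add, ih, functional_smul, h1, add_zero]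
    exact h2 _
  have : IsNoetherian K (socle R M k) := isNoetherian_of_injective f hf
  have : IsNoetherian R (socle R M k) := isNoetherian_of_tower K this
  obtain ⟨e, he⟩ := monotone_stabilizes_iff_noetherian.2 this
    ⟨fun e => (V e).comap (socle R M k).subtype, fun i j hij => Submodule.comap_mono (V.mono hij)⟩
  refine ⟨e, fun e' hee' => ?_⟩
  have h : ((V e).comap (socle R M k).subtype).map (socle R M k).subtype =
      ((V e').comap (socle R M k).subtype).map (socle R M k).subtype :=
    congrArg _ (he e' hee')
  rwa [Submodule.map_comap_subtype, Submodule.map_comap_subtype, inf_comm, inf_comm _ (V e')] at h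

variable (p : ℕ) [Fact p.Prime] [ExpChar K p] [PerfectRing K p] [ExpChar R p]
  (F : M →ₛₗ[frobenius R p] M)

/-- The elements killed by `F ^ e`, as a submodule. -/
def kerIterate (e : ℕ) : Submodule R M where
  carrier := {z | F^[e] z = 0}
  zero_mem' := iterate_map_zero F e
  add_mem' {z w} hz hw := by
    change F^[e] (z + w) = 0
    rw [iterate_map_add, hz, hw, add_zero]
  smul_mem' r z hz := by
    change F^[e] (r • z) = 0
    rw [iterate_smul, hz, smul_zero]

theorem mem_kerIterate {e : ℕ} {z : M} : z ∈ kerIterate p F e ↔ F^[e] z = 0 := Iff.rfl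

theorem kerIterate_mono : Monotone (kerIterate p F) := by
  intro e e' h z hz
  obtain ⟨k, rfl⟩ := Nat.exists_eq_add_of_le' h
  rw [mem_kerIterate] at hz ⊢
  rw [Function.iterate_add_apply, hz, iterate_map_zero]

theorem frobenius_transpose_smul (φ : CoDual K R M) (k : K) (z : M) :
    ((frobeniusEquiv K p).symm.toAddMonoidHom.comp ((functional φ).comp F.toAddMonoidHom))
      (algebraMap K R k • z) = k * ((frobeniusEquiv K p).symm.toAddMonoidHom.comp
      ((functional φ).comp F.toAddMonoidHom)) z := by
  change (frobeniusEquiv K p).symm (functional φ (F (algebraMap K R k • z))) =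
    k * (frobeniusEquiv K p).symm (functional φ (F z))
  rw [F.map_smulₛₗ, ← RingHom.map_frobenius, functional_algebraMap_smul, map_mul,
    frobeniusEquiv_symm_apply_frobenius]

/-- The transpose of a Frobenius action. -/
def cartier : CoDual K R M →+ CoDual K R M where
  toFun φ := ofFunctional _ (frobenius_transpose_smul p F φ)
  map_zero' := CoDual.ext fun z => by
    rw [functional_ofFunctional]
    exact map_zero (frobeniusEquiv K p).symm
  map_add' φ ψ := CoDual.ext fun z => by
    rw [functional_add, functional_ofFunctional, functional_ofFunctional, functional_ofFunctional]
    exact map_add (frobeniusEquiv K p).symm _ _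

theorem functional_cartier (φ : CoDual K R M) (z : M) :
    functional (cartier p F φ) z = (frobeniusEquiv K p).symm (functional φ (F z)) :=
  functional_ofFunctional _ (frobenius_transpose_smul p F φ) z

theorem cartier_smul (r : R) (φ : CoDual K R M) :
    cartier p F (frobenius R p r • φ) = r • cartier p F φ := CoDual.ext fun z => by
  rw [functional_smul, functional_cartier, functional_cartier, functional_smul, F.map_smulₛₗ]

/-- The transpose `Φ` of the action, taken along approximate generators of `R` over its `p`-th
powers, is injective because `F` spans. As it turns `p`-th powers into first powers of scalars,
Artin–Rees lets it reflect membership in a suitable `𝔪 ^ k • ⊤`. Dually, the `k`-th socle layer lies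
in the span of its own image under `F`, which contradicts nilpotence unless the layer is zero. -/
theorem eq_zero_of_nilpotent
    (hK : Function.Surjective ((residue R).comp (algebraMap K R))) (hM : IsMTorsion R M)
    (hc : IsCofinite K R M) (hF : Submodule.span R (Set.range F) = ⊤)
    (hn : ∀ z, ∃ e, F^[e] z = 0) (z : M) : z = 0 := by
  have : Module.Finite R (CoDual K R M) := hc
  obtain ⟨n, g, hg⟩ := exists_frobenius_span (K := K) p hK
  set 𝔪 := maximalIdeal R
  let Φ : CoDual K R M →+ (Fin n → CoDual K R M) :=
    { toFun := fun φ i => cartier p F (g i • φ)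
      map_zero' := by
        funext i
        rw [smul_zero, map_zero]
        rfl
      map_add' := fun φ ψ => by
        funext i
        rw [smul_add, map_add]
        rfl }
  have hΦ (r : R) (φ : CoDual K R M) : Φ (frobenius R p r • φ) = r • Φ φ := by
    funext i
    change cartier p F (g i • frobenius R p r • φ) = r • cartier p F (g i • φ)
    rw [smul_comm, cartier_smul]
  have hinj (φ : CoDual K R M) (h : Φ φ = 0) : φ = 0 := by
    have h0 (i : Fin n) (w : M) : functional φ (g i • F w) = 0 := by
      have := congrArg (fun ψ => functional ψ w) (congrFun h i)
      change functional (cartier p F (g i • φ)) w = 0 at this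
      rwa [functional_cartier, EmbeddingLike.map_eq_zero_iff, functional_smul] at this
    refine CoDual.ext fun w => ?_
    obtain ⟨l, f, b, rfl⟩ := Submodule.mem_span_set'.1 (hF.ge (Submodule.mem_top (x := w)))
    rw [map_sum]
    change _ = 0
    refine Finset.sum_eq_zero fun j _ => ?_
    obtain ⟨y, hy⟩ := (b j).2
    rw [← hy]
    obtain ⟨k, hk⟩ := hM y
    obtain ⟨s, hs⟩ := hg k (f j)
    -- Since `𝔪 ^ k` kills `y`, its Frobenius image kills `F y`. Hence the coefficient `f j` may be
    -- replaced by its approximation, which `h0` handles.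
    have h1 : ∀ q ∈ (𝔪 ^ k).map (frobenius R p), q • F y = 0 := by
      intro q hq
      obtain ⟨m, c, a, rfl⟩ := Submodule.mem_span_set'.1 hq
      rw [Finset.sum_smul]
      refine Finset.sum_eq_zero fun i _ => ?_
      obtain ⟨a', ha', haa⟩ := (a i).2
      rw [smul_assoc, ← haa, ← F.map_smulₛₗ, hk a' ha', map_zero, smul_zero]
    have h2 := h1 _ hs
    rw [sub_smul, sub_eq_zero] at h2
    rw [h2, Finset.sum_smul, map_sum]
    refine Finset.sum_eq_zero fun i _ => ?_
    rw [mul_comm, mul_smul, ← F.map_smulₛₗ, h0]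
  let T : Submodule R (Fin n → CoDual K R M) :=
    { Φ.range.toAddSubmonoid with
      smul_mem' := by
        rintro r _ ⟨φ, rfl⟩
        exact ⟨frobenius R p r • φ, hΦ r φ⟩ }
  obtain ⟨c, hc⟩ := Ideal.exists_pow_inf_eq_pow_smul 𝔪 T
  have hT (j : ℕ) : ∀ ψ ∈ 𝔪 ^ j • T, ∃ φ ∈ (𝔪 ^ (p * j) • ⊤ : Submodule R (CoDual K R M)),
      Φ φ = ψ := by
    intro ψ hψ
    induction hψ using Submodule.smul_induction_on' with
    | smul r hr ψ hψ =>
      obtain ⟨φ, rfl⟩ := hψ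
      refine ⟨frobenius R p r • φ, Submodule.smul_mem_smul ?_ trivial, hΦ r φ⟩
      rw [frobenius_def, mul_comm, pow_mul]
      exact Ideal.pow_mem_pow hr p
    | add ψ _ ψ' _ h1 h2 =>
      obtain ⟨φ, hφ, rfl⟩ := h1
      obtain ⟨φ', hφ', rfl⟩ := h2
      exact ⟨φ + φ', add_mem hφ hφ', map_add _ _ _⟩
  -- With the Artin–Rees constant `c`, this gives `p * (k - c) ≥ 2 * (c + 1) ≥ k`, so the factor `p`
  -- from Frobenius outweighs the loss of `c`. Also `k ≠ 0`, as `eq_zero_of_socle_eq_bot` requires.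
  set k := 2 * c + 1
  have hdesc (φ : CoDual K R M)
      (h : ∀ i, cartier p F (g i • φ) ∈ (𝔪 ^ k • ⊤ : Submodule R (CoDual K R M))) :
      φ ∈ (𝔪 ^ k • ⊤ : Submodule R (CoDual K R M)) := by
    have h1 : Φ φ ∈ 𝔪 ^ k • ⊤ ⊓ T := ⟨(mem_smul_top_pi _ _).2 h, ⟨φ, rfl⟩⟩
    rw [hc k (by omega)] at h1
    obtain ⟨φ', hφ', he⟩ := hT _ _ (Submodule.smul_mono le_rfl inf_le_right h1)
    have : φ = φ' := by
      rw [← sub_eq_zero]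
      apply hinj
      rw [map_sub, he, sub_self]
    rw [this]
    refine Submodule.smul_mono (Ideal.pow_le_pow_right ?_) le_rfl hφ'
    have := Nat.mul_le_mul_right (k - c) (Fact.out : p.Prime).two_le
    omega
  -- A functional vanishing on the right-hand span has all its transposes `cartier p F (g i • φ)`
  -- vanishing on the socle layer; by `hdesc` it vanishes there itself.
  have hstep : socle R M k ≤ Submodule.span R (F '' socle R M k) := by
    intro w hw
    by_contra hw'
    obtain ⟨φ, hφ, hφw⟩ := exists_coDual_separating (K := K) _ hw'
    refine hφw (functional_eq_zero_of_mem_smul (hdesc φ fun i => ?_) (mem_socle.1 hw))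
    refine mem_smul_of_functional_eq_zero _ fun y hy => ?_
    rw [functional_cartier, functional_smul, hφ, map_zero]
    exact Submodule.smul_mem _ _ (Submodule.subset_span ⟨y, mem_socle.2 hy, rfl⟩)
  have hiter (e : ℕ) : socle R M k ≤ Submodule.span R (F^[e] '' socle R M k) := by
    induction e with
    | zero => simp
    | succ e ih =>
      refine hstep.trans (Submodule.span_le.2 ?_)
      rintro _ ⟨y, hy, rfl⟩
      obtain ⟨l, f, b, rfl⟩ := Submodule.mem_span_set'.1 (ih hy)
      rw [map_sum]
      refine Submodule.sum_mem _ fun i _ => ?_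
      obtain ⟨a, ha, hab⟩ := (b i).2
      rw [F.map_smulₛₗ, ← hab, ← Function.iterate_succ_apply' F]
      exact Submodule.smul_mem _ _ (Submodule.subset_span ⟨a, ha, rfl⟩)
  obtain ⟨e, he⟩ := exists_stable_of_socle hK ‹_› k ⟨kerIterate p F, kerIterate_mono p F⟩
  refine eq_zero_of_socle_eq_bot hM (k := k) (by omega) ?_ z
  rw [eq_bot_iff]
  refine (hiter e).trans (Submodule.span_le.2 ?_)
  rintro _ ⟨y, hy, rfl⟩
  obtain ⟨e', he'⟩ := hn y
  have h1 : y ∈ kerIterate p F (max e e') ⊓ socle R M k :=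
    ⟨kerIterate_mono p F (le_max_right _ _) he', hy⟩
  have h2 := he (max e e') (le_max_left _ _)
  exact (h2.symm.le h1).1

/-- The spans `V e` decrease and their annihilators in the Noetherian dual increase, so `V e` equals
the span of `F '' V e` for some `e`. Then `eq_zero_of_nilpotent` applies to `V e` and makes it zero.
-/
theorem exists_iterate_eq_zero
    (hK : Function.Surjective ((residue R).comp (algebraMap K R))) (hM : IsMTorsion R M)
    (hc : IsCofinite K R M) : ∃ e, ∀ z, (∃ e', F^[e'] z = 0) → F^[e] z = 0 := by
  have : Module.Finite R (CoDual K R M) := hc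
  let V : ℕ → Submodule R M := fun e => Submodule.span R (F^[e] '' {z | ∃ e', F^[e'] z = 0})
  have hV (e : ℕ) : V (e + 1) = Submodule.span R (F '' V e) := by
    refine le_antisymm (Submodule.span_le.2 ?_) (Submodule.span_le.2 ?_)
    · rintro _ ⟨z, hz, rfl⟩
      refine Submodule.subset_span ⟨F^[e] z, Submodule.subset_span ⟨z, hz, rfl⟩, ?_⟩
      rw [Function.iterate_succ_apply']
    · rintro _ ⟨y, hy, rfl⟩
      obtain ⟨l, f, b, rfl⟩ := Submodule.mem_span_set'.1 hy
      rw [map_sum]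
      refine Submodule.sum_mem _ fun i _ => ?_
      obtain ⟨a, ha, hab⟩ := (b i).2
      rw [F.map_smulₛₗ, ← hab, ← Function.iterate_succ_apply' F]
      exact Submodule.smul_mem _ _ (Submodule.subset_span ⟨a, ha, rfl⟩)
  have hVanti : Antitone V := by
    refine antitone_nat_of_succ_le fun e => Submodule.span_le.2 ?_
    rintro _ ⟨z, ⟨e', hz⟩, rfl⟩
    refine Submodule.subset_span ⟨F z, ⟨e', ?_⟩, rfl⟩
    rw [← Function.iterate_succ_apply, Function.iterate_succ_apply', hz, map_zero]
  have hVnil (e : ℕ) (z : M) (hz : z ∈ V e) : ∃ e', F^[e'] z = 0 := by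
    induction hz using Submodule.span_induction with
    | mem z hz =>
      obtain ⟨y, ⟨e', hy⟩, rfl⟩ := hz
      refine ⟨e', ?_⟩
      rw [← Function.iterate_add_apply, add_comm, Function.iterate_add_apply, hy, iterate_map_zero]
    | zero => exact ⟨0, rfl⟩
    | add z w _ _ h1 h2 =>
      obtain ⟨a, ha⟩ := h1
      obtain ⟨b, hb⟩ := h2
      exact ⟨max a b, add_mem (kerIterate_mono p F (le_max_left a b) ha)
        (kerIterate_mono p F (le_max_right a b) hb)⟩
    | smul r z _ h =>
      obtain ⟨a, ha⟩ := h
      exact ⟨a, (kerIterate p F a).smul_mem r ha⟩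
  let A : ℕ →o Submodule R (CoDual K R M) :=
    { toFun := fun e =>
        { carrier := {φ | ∀ z ∈ V e, functional φ z = 0}
          zero_mem' := fun z _ => rfl
          add_mem' := fun {φ ψ} hφ hψ z hz => by rw [functional_add, hφ z hz, hψ z hz, add_zero]
          smul_mem' := fun r φ hφ z hz => by
            rw [functional_smul]
            exact hφ _ ((V e).smul_mem r hz) }
      monotone' := fun e e' h φ hφ z hz => hφ z (hVanti h hz) }
  obtain ⟨e, he⟩ := monotone_stabilizes_iff_noetherian.2 (inferInstance :
    IsNoetherian R (CoDual K R M)) A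
  have hstable : V e ≤ V (e + 1) := by
    intro z hz
    by_contra hz'
    obtain ⟨φ, hφ, hφz⟩ := exists_coDual_separating (K := K) _ hz'
    have : φ ∈ A e := by
      rw [he (e + 1) (Nat.le_succ e)]
      exact hφ
    exact hφz (this z hz)
  have hFV : ∀ z ∈ V e, F z ∈ V e := fun z hz => hVanti (Nat.le_succ e) <| by
    change F z ∈ V (e + 1)
    rw [hV]
    exact Submodule.subset_span ⟨z, hz, rfl⟩
  let F' : V e →ₛₗ[frobenius R p] V e := F.restrict hFV
  have hF' (j : ℕ) (z : V e) : ((F'^[j] z : V e) : M) = F^[j] z := by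
    induction j with
    | zero => rfl
    | succ j ih =>
      rw [Function.iterate_succ_apply', Function.iterate_succ_apply', ← ih]
      rfl
  refine ⟨e, fun z hz => ?_⟩
  have hz' : F^[e] z ∈ V e := Submodule.subset_span ⟨z, hz, rfl⟩
  refine congrArg Subtype.val (eq_zero_of_nilpotent (K := K) p F' hK (hM.submodule _)
    (hc.of_injective (V e).subtype Subtype.val_injective) ?_ ?_ ⟨_, hz'⟩)
  · apply Submodule.map_injective_of_injective (V e).subtype_injective
    rw [Submodule.map_span, Submodule.map_top, Submodule.range_subtype]
    refine le_antisymm (Submodule.span_le.2 ?_) ?_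
    · rintro _ ⟨_, ⟨y, rfl⟩, rfl⟩
      exact hFV _ y.2
    · refine hstable.trans ?_
      rw [hV]
      refine Submodule.span_mono ?_
      rintro _ ⟨y, hy, rfl⟩
      exact ⟨F' ⟨y, hy⟩, ⟨_, rfl⟩, rfl⟩
  · intro y
    obtain ⟨e', he'⟩ := hVnil e y y.2
    exact ⟨e', Subtype.ext ((hF' e' y).trans he')⟩

end HSL

open TensorProduct

/-! ### Cohomology of a flat complex with coefficients in a module -/

section FlatComplex

variable {R : Type u} [CommRing R] {C : ℕ → Type u} [∀ i, AddCommGroup (C i)]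
  [∀ i, Module R (C i)] (δ : ∀ i, C i →ₗ[R] C (i + 1))
  {N N' : Type u} [AddCommGroup N] [Module R N] [AddCommGroup N'] [Module R N']

variable (N) in
/-- The cocycles with coefficients in `N`. -/
def cocyclesCoeff (i : ℕ) : Submodule R (C i ⊗[R] N) := LinearMap.ker ((δ i).rTensor N)

variable (N) in
/-- The coboundaries with coefficients in `N`. -/
def coboundariesCoeff : ∀ i : ℕ, Submodule R (C i ⊗[R] N)
  | 0 => ⊥
  | i + 1 => LinearMap.range ((δ i).rTensor N)

variable (N) in
/-- The cohomology with coefficients in `N`. -/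
abbrev cohCoeff (i : ℕ) : Type u :=
  cocyclesCoeff δ N i ⧸ (coboundariesCoeff δ N i).submoduleOf (cocyclesCoeff δ N i)

theorem rTensor_lTensor_comm {A B : Type*} [AddCommGroup A] [Module R A] [AddCommGroup B]
    [Module R B] (g : A →ₗ[R] B) (f : N →ₗ[R] N') (c : A ⊗[R] N) :
    g.rTensor N' (f.lTensor A c) = f.lTensor B (g.rTensor N c) := by
  rw [← LinearMap.comp_apply, ← LinearMap.comp_apply, LinearMap.rTensor_comp_lTensor,
    LinearMap.lTensor_comp_rTensor]

theorem lTensor_mem_coboundaries (f : N →ₗ[R] N') {i : ℕ} {c : C i ⊗[R] N}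
    (hc : c ∈ coboundariesCoeff δ N i) : f.lTensor (C i) c ∈ coboundariesCoeff δ N' i := by
  cases i with
  | zero =>
    have : c = 0 := hc
    rw [this, map_zero]
    exact zero_mem _
  | succ i =>
    obtain ⟨b, rfl⟩ := hc
    exact ⟨f.lTensor (C i) b, rTensor_lTensor_comm _ _ _⟩

theorem exists_coboundary_lift (f : N →ₗ[R] N') (hf : Function.Surjective f) {i : ℕ}
    {c : C i ⊗[R] N'} (hc : c ∈ coboundariesCoeff δ N' i) :
    ∃ b ∈ coboundariesCoeff δ N i, f.lTensor (C i) b = c := by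
  cases i with
  | zero =>
    have : c = 0 := hc
    exact ⟨0, zero_mem _, by rw [this, map_zero]⟩
  | succ i =>
    obtain ⟨b, rfl⟩ := hc
    obtain ⟨b', rfl⟩ := LinearMap.lTensor_surjective (C i) hf b
    exact ⟨_, ⟨b', rfl⟩, (rTensor_lTensor_comm _ _ _).symm⟩

/-- The map on cocycles induced by a map of coefficients. -/
def cocyclesCoeffMap (f : N →ₗ[R] N') (i : ℕ) : cocyclesCoeff δ N i →ₗ[R] cocyclesCoeff δ N' i :=
  (f.lTensor (C i)).restrict fun c hc => by
    change (δ i).rTensor N' (f.lTensor (C i) c) = 0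
    rw [rTensor_lTensor_comm, show (δ i).rTensor N c = 0 from hc, map_zero]

/-- The map on cohomology induced by a map of coefficients. -/
def cohCoeffMap (f : N →ₗ[R] N') (i : ℕ) : cohCoeff δ N i →ₗ[R] cohCoeff δ N' i :=
  Submodule.mapQ _ _ (cocyclesCoeffMap δ f i) fun _ hc => lTensor_mem_coboundaries δ f hc

theorem cohCoeff_mk_eq_zero {i : ℕ} (c : cocyclesCoeff δ N i) :
    (Submodule.Quotient.mk c : cohCoeff δ N i) = 0 ↔ c.1 ∈ coboundariesCoeff δ N i := by
  rw [Submodule.Quotient.mk_eq_zero]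
  rfl

section Complex

variable (hδ : ∀ i c, δ (i + 1) (δ i c) = 0)
include hδ

theorem rTensor_rTensor_eq_zero (i : ℕ) (c : C i ⊗[R] N) :
    (δ (i + 1)).rTensor N ((δ i).rTensor N c) = 0 := by
  rw [← LinearMap.comp_apply, ← LinearMap.rTensor_comp,
    show (δ (i + 1)).comp (δ i) = 0 from LinearMap.ext (hδ i), LinearMap.rTensor_zero,
    LinearMap.zero_apply]

theorem coboundariesCoeff_le (i : ℕ) : coboundariesCoeff δ N i ≤ cocyclesCoeff δ N i := by
  cases i with
  | zero => exact bot_le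
  | succ i =>
    rintro _ ⟨c, rfl⟩
    exact rTensor_rTensor_eq_zero δ hδ i c

end Complex

variable {K : Type v} [Field K] [Algebra K R] [IsNoetherianRing R] [IsLocalRing R]
  [∀ i, Module.Flat R (C i)]

/-- Flatness keeps the coefficient sequence exact in each degree; only exactness of cohomology at
the middle term is then needed. -/
theorem isCofinite_cohCoeff_of_exact (hδ : ∀ i c, δ (i + 1) (δ i c) = 0)
    {N'' : Type u} [AddCommGroup N''] [Module R N'']
    (f : N →ₗ[R] N') (g : N' →ₗ[R] N'') (hf : Function.Injective f) (hg : Function.Surjective g)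
    (hfg : Function.Exact f g) (i : ℕ) (h : IsCofinite K R (cohCoeff δ N i))
    (h'' : IsCofinite K R (cohCoeff δ N'' i)) : IsCofinite K R (cohCoeff δ N' i) := by
  refine h.of_exact h'' (cohCoeffMap δ f i) (cohCoeffMap δ g i) fun z hz => ?_
  obtain ⟨c, rfl⟩ := Submodule.Quotient.mk_surjective _ z
  have hz' := (cohCoeff_mk_eq_zero δ (cocyclesCoeffMap δ g i c)).1 hz
  obtain ⟨b, hb, hbc⟩ := exists_coboundary_lift δ g hg hz'
  have h1 : g.lTensor (C i) (c.1 - b) = 0 := by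
    rw [map_sub, hbc]
    exact sub_self _
  obtain ⟨a, ha⟩ := (lTensor_exact (C i) hfg hg _).1 h1
  have ha' : a ∈ cocyclesCoeff δ N i := by
    apply Module.Flat.lTensor_preserves_injective_linearMap (M := C (i + 1)) f hf
    rw [← rTensor_lTensor_comm, ha, map_sub, map_zero,
      show (δ i).rTensor N' b = 0 from coboundariesCoeff_le δ hδ i hb,
      show (δ i).rTensor N' c.1 = 0 from c.2, sub_zero]
  refine ⟨Submodule.Quotient.mk ⟨a, ha'⟩, ?_⟩
  change Submodule.Quotient.mk (cocyclesCoeffMap δ f i ⟨a, ha'⟩) = _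
  rw [← sub_eq_zero, ← Submodule.Quotient.mk_sub, cohCoeff_mk_eq_zero]
  change f.lTensor (C i) a - c.1 ∈ _
  rw [ha, sub_sub_cancel_left]
  exact neg_mem hb

theorem smul_lTensor_injective {y : R} (hreg : ∀ z : N, y • z = 0 → z = 0) {i : ℕ}
    {c : C i ⊗[R] N} (hc : y • c = 0) : c = 0 := by
  have hinj : Function.Injective (LinearMap.lsmul R N y) :=
    (injective_iff_map_eq_zero _).2 hreg
  apply Module.Flat.lTensor_preserves_injective_linearMap (M := C i) _ hinj
  rw [map_zero, ← hc]
  have : (LinearMap.lsmul R N y).lTensor (C i) = LinearMap.lsmul R (C i ⊗[R] N) y := by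
    refine TensorProduct.ext' fun a b => ?_
    simp
  rw [this, LinearMap.lsmul_apply]

variable [IsAdicComplete (maximalIdeal R) R]

/-- In degree 0 there are no nonzero coboundaries, so by flatness `y` acts injectively and its
torsion is zero. -/
theorem isCofinite_cohCoeff_zero {y : R} (hy : y ∈ maximalIdeal R)
    (hreg : ∀ z : N, y • z = 0 → z = 0) (ht : IsMTorsion R (cohCoeff δ N 0)) :
    IsCofinite K R (cohCoeff δ N 0) := by
  refine ht.isCofinite hy ?_
  have : Subsingleton (LinearMap.ker (LinearMap.lsmul R (cohCoeff δ N 0) y)) := by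
    refine subsingleton_of_forall_eq 0 fun z => Subtype.ext ?_
    obtain ⟨z, hz⟩ := z
    obtain ⟨c, rfl⟩ := Submodule.Quotient.mk_surjective _ z
    have h1 : (Submodule.Quotient.mk (y • c) : cohCoeff δ N 0) = 0 := hz
    rw [cohCoeff_mk_eq_zero] at h1
    have h2 : c.1 = 0 := smul_lTensor_injective hreg h1
    obtain rfl : c = 0 := Subtype.ext h2
    rfl
  exact isCofinite_of_subsingleton

/-- By the long exact sequence of multiplication by `y`, the `y`-torsion in degree `i + 1` is the
image of degree `i` with coefficients in `N / yN`, which `N'` represents. -/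
theorem isCofinite_cohCoeff_succ (hδ : ∀ i c, δ (i + 1) (δ i c) = 0) {y : R}
    (hy : y ∈ maximalIdeal R) (hreg : ∀ z : N, y • z = 0 → z = 0) (π : N →ₗ[R] N')
    (hπ : Function.Surjective π) (hyπ : Function.Exact (LinearMap.lsmul R N y) π) {i : ℕ}
    (ht : IsMTorsion R (cohCoeff δ N (i + 1))) (h : IsCofinite K R (cohCoeff δ N' i)) :
    IsCofinite K R (cohCoeff δ N (i + 1)) := by
  refine ht.isCofinite hy ?_
  have hlsmul (A : Type u) [AddCommGroup A] [Module R A] :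
      (LinearMap.lsmul R N y).lTensor A = LinearMap.lsmul R (A ⊗[R] N) y :=
    TensorProduct.ext' fun a b => by simp
  have hπ0 {j : ℕ} (c : C j ⊗[R] N) : π.lTensor (C j) (y • c) = 0 := by
    have := (lTensor_exact (C j) hyπ hπ (y • c)).2 ⟨c, by rw [hlsmul, LinearMap.lsmul_apply]⟩
    exact this
  -- The connecting map is kept as a correspondence: pairs `(b, c)` with `δ b = y • c`.
  -- Well-definedness becomes the kernel condition of `IsCofinite.of_ker_le`.
  let W : Submodule R ((C i ⊗[R] N) × (C (i + 1) ⊗[R] N)) :=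
    LinearMap.eqLocus (((δ i).rTensor N).comp (LinearMap.fst R _ _))
      ((LinearMap.lsmul R _ y).comp (LinearMap.snd R _ _))
  have hW (w : W) : (δ i).rTensor N w.1.1 = y • w.1.2 := w.2
  let f₀ : W →ₗ[R] cocyclesCoeff δ N' i :=
    ((π.lTensor (C i)).comp ((LinearMap.fst R _ _).comp W.subtype)).codRestrict _ fun w => by
      change (δ i).rTensor N' (π.lTensor (C i) w.1.1) = 0
      rw [rTensor_lTensor_comm, hW, hπ0]
  have hg₀ (w : W) : w.1.2 ∈ cocyclesCoeff δ N (i + 1) := by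
    refine smul_lTensor_injective (C := C) hreg (y := y) (c := (δ (i + 1)).rTensor N w.1.2) ?_
    rw [← map_smul, ← hW, rTensor_rTensor_eq_zero δ hδ]
  let g₀ : W →ₗ[R] cocyclesCoeff δ N (i + 1) :=
    ((LinearMap.snd R _ _).comp W.subtype).codRestrict _ hg₀
  let g : W →ₗ[R] cohCoeff δ N (i + 1) := (Submodule.mkQ _).comp g₀
  have hg (w : W) : g w ∈ LinearMap.ker (LinearMap.lsmul R (cohCoeff δ N (i + 1)) y) := by
    change (Submodule.Quotient.mk (y • g₀ w) : cohCoeff δ N (i + 1)) = 0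
    rw [cohCoeff_mk_eq_zero]
    exact ⟨w.1.1, hW w⟩
  refine h.of_ker_le ((Submodule.mkQ _).comp f₀) (g.codRestrict _ hg) ?_ ?_
  · rintro ⟨z, hz⟩
    obtain ⟨c, rfl⟩ := Submodule.Quotient.mk_surjective _ z
    have h1 : (Submodule.Quotient.mk (y • c) : cohCoeff δ N (i + 1)) = 0 := hz
    rw [cohCoeff_mk_eq_zero] at h1
    obtain ⟨b, hb⟩ := h1
    exact ⟨⟨(b, c.1), hb⟩, rfl⟩
  · intro w hw
    have h1 := (cohCoeff_mk_eq_zero δ (f₀ w)).1 hw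
    obtain ⟨b, hb, hbw⟩ := exists_coboundary_lift δ π hπ h1
    have h2 : π.lTensor (C i) (w.1.1 - b) = 0 := by
      rw [map_sub, hbw]
      exact sub_self _
    obtain ⟨a, ha⟩ := (lTensor_exact (C i) hyπ hπ _).1 h2
    rw [hlsmul, LinearMap.lsmul_apply] at ha
    refine Subtype.ext ((cohCoeff_mk_eq_zero δ (g₀ w)).2 ⟨a, ?_⟩)
    rw [← sub_eq_zero]
    refine smul_lTensor_injective (C := C) hreg (y := y) ?_
    change y • ((δ i).rTensor N a - w.1.2) = 0
    rw [smul_sub, ← map_smul, ha, map_sub, hW,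
      show (δ i).rTensor N b = 0 from coboundariesCoeff_le δ hδ i hb, sub_zero, sub_self]

theorem isCofinite_cohCoeff_of_isCofinite {i : ℕ} (h : IsCofinite K R (C i ⊗[R] N)) :
    IsCofinite K R (cohCoeff δ N i) :=
  (h.of_injective (cocyclesCoeff δ N i).subtype Subtype.val_injective).of_surjective
    (Submodule.mkQ _) (Submodule.mkQ_surjective _)

/-- Dévissage to the modules `R ⧸ P` with `P` prime: either `P` is maximal, or an element of the
maximal ideal outside `P` is regular on the quotient. -/
theorem isCofinite_cohCoeff_of_regular (hδ : ∀ i c, δ (i + 1) (δ i c) = 0) {i : ℕ}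
    (hres : IsCofinite K R (C i ⊗[R] (R ⧸ maximalIdeal R)))
    (hreg : ∀ (N : Type u) [AddCommGroup N] [Module R N] [Module.Finite R N],
      ∀ y ∈ maximalIdeal R, (∀ z : N, y • z = 0 → z = 0) → IsCofinite K R (cohCoeff δ N i))
    (N : Type u) [AddCommGroup N] [Module R N] [Module.Finite R N] :
    IsCofinite K R (cohCoeff δ N i) := by
  induction ‹Module.Finite R N› using IsNoetherianRing.induction_on_isQuotientEquivQuotientPrime
  with
  | subsingleton N =>
    have : Subsingleton (C i ⊗[R] N) := inferInstance
    exact isCofinite_cohCoeff_of_isCofinite δ isCofinite_of_subsingleton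
  | quotient N P e =>
    obtain ⟨P, hP⟩ := P
    change N ≃ₗ[R] R ⧸ P at e
    by_cases hPm : P = maximalIdeal R
    · subst hPm
      exact isCofinite_cohCoeff_of_isCofinite δ (hres.of_surjective (e.symm.toLinearMap.lTensor _)
        (LinearMap.lTensor_surjective _ e.symm.surjective))
    · obtain ⟨y, hy, hyP⟩ := SetLike.exists_of_lt (lt_of_le_of_ne (le_maximalIdeal hP.ne_top) hPm)
      refine hreg N y hy fun z hz => ?_
      have h1 : Ideal.Quotient.mk P y * e z = 0 := by
        have := congrArg e hz
        rw [map_smul, map_zero, Algebra.smul_def] at this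
        exact this
      rcases mul_eq_zero.1 h1 with h | h
      · exact absurd (Ideal.Quotient.eq_zero_iff_mem.1 h) hyP
      · exact e.map_eq_zero_iff.1 h
  | exact N₁ N₂ N₃ f g hf hg hfg h₁ h₃ =>
    exact isCofinite_cohCoeff_of_exact δ hδ f g hf hg hfg i h₁ h₃

/-- The cohomology of a bounded below complex of flat modules with coefficients in finitely
generated modules is cofinite if it is torsion with respect to the maximal ideal and the complex
tensored with the residue field is cofinite. -/
theorem isCofinite_cohCoeff (hδ : ∀ i c, δ (i + 1) (δ i c) = 0)
    (hres : ∀ i, IsCofinite K R (C i ⊗[R] (R ⧸ maximalIdeal R)))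
    (ht : ∀ (N : Type u) [AddCommGroup N] [Module R N] (i : ℕ), IsMTorsion R (cohCoeff δ N i))
    (i : ℕ) (N : Type u) [AddCommGroup N] [Module R N] [Module.Finite R N] :
    IsCofinite K R (cohCoeff δ N i) := by
  induction i generalizing N with
  | zero =>
    exact isCofinite_cohCoeff_of_regular δ hδ (hres 0)
      (fun N _ _ _ y hy hreg => isCofinite_cohCoeff_zero δ hy hreg (ht N 0)) N
  | succ i ih =>
    refine isCofinite_cohCoeff_of_regular δ hδ (hres _) (fun N _ _ _ y hy hreg => ?_) N
    exact isCofinite_cohCoeff_succ δ hδ hy hreg (LinearMap.range (LinearMap.lsmul R N y)).mkQ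
      (Submodule.mkQ_surjective _) (LinearMap.exact_map_mkQ_range _) (ht N _) (ih _)

end FlatComplex

/-! ### Torsion and cofiniteness of Čech cohomology -/

section Contraction

variable {R : Type u} [CommRing R] {n : ℕ} (x : Fin n → R)

/-- The canonical map between localizations for `s ⊆ t`, as an `R`-linear map. -/
def resLin {s t : Finset (Fin n)} (h : s ⊆ t) : Loc x s →ₗ[R] Loc x t :=
  { res x h with map_smul' := fun r z => awayMap_smul _ _ r z }

@[simp]
theorem resLin_apply {s t : Finset (Fin n)} (h : s ⊆ t) (z : Loc x s) :
    resLin x h z = res x h z := rfl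

theorem res_self {s : Finset (Fin n)} (h : s ⊆ s) (z : Loc x s) : res x h z = z := by
  have : res x h = RingHom.id _ :=
    IsLocalization.ringHom_ext (Submonoid.powers (∏ j ∈ s, x j)) (RingHom.ext fun r => by simp [res])
  rw [this, RingHom.id_apply]

variable (j : Fin n)

/-- Čech cochains of degree `i` after localization at `x j`. -/
abbrev LocCochain (i : ℕ) : Type u :=
  ∀ s : {s : Finset (Fin n) // s.card = i}, Loc x (insert j s.1)

/-- The localization map on cochains. -/
def toLocCochain (i : ℕ) : Cochain x i →ₗ[R] LocCochain x j i :=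
  .pi fun s => resLin x (Finset.subset_insert j s.1) ∘ₗ .proj s

/-- The localized differential. -/
def locD (i : ℕ) : LocCochain x j i →ₗ[R] LocCochain x j (i + 1) :=
  .pi fun t => ∑ k : t.1, ((-1 : R) ^ pos t.1 k.1) •
    (resLin x (Finset.insert_subset_insert j (face_subset t k)) ∘ₗ .proj (face t k))

/-- The contraction of the Čech complex after localization at `x j`. -/
def contraction (i : ℕ) : Cochain x (i + 1) →ₗ[R] LocCochain x j i :=
  .pi fun s => if h : j ∈ s.1 then 0 else
    ((-1 : R) ^ pos (insert j s.1) j) •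
      .proj (⟨insert j s.1, by rw [Finset.card_insert_of_notMem h, s.2]⟩ :
        {s : Finset (Fin n) // s.card = i + 1})

theorem toLocCochain_apply (i : ℕ) (c : Cochain x i) (s) :
    toLocCochain x j i c s = res x (Finset.subset_insert j s.1) (c s) := rfl

theorem locD_apply (i : ℕ) (c : LocCochain x j i) (t) :
    locD x j i c t = ∑ k : t.1, (-1) ^ pos t.1 k.1 *
      res x (Finset.insert_subset_insert j (face_subset t k)) (c (face t k)) := by
  simp [locD, Algebra.smul_def]

theorem contraction_of_mem (i : ℕ) (c : Cochain x (i + 1)) (s) (h : j ∈ s.1) :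
    contraction x j i c s = 0 := by
  simp [contraction, h]

theorem contraction_of_notMem (i : ℕ) (c : Cochain x (i + 1)) (s) (h : j ∉ s.1)
    (t : {s : Finset (Fin n) // s.card = i + 1}) (ht : t.1 = insert j s.1) :
    contraction x j i c s = (-1) ^ pos t.1 j * res x ht.le (c t) := by
  obtain ⟨t, ht'⟩ := t
  dsimp only at ht
  subst ht
  rw [res_self]
  simp [contraction, h, Algebra.smul_def]

theorem neg_one_pow_mul_self {A : Type*} [CommRing A] (m : ℕ) (a : A) :
    (-1) ^ m * ((-1) ^ m * a) = a := by
  rw [← mul_assoc, ← mul_pow, neg_one_mul, neg_neg, one_pow, one_mul]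

theorem locD_toLocCochain (i : ℕ) (c : Cochain x i) :
    locD x j i (toLocCochain x j i c) = toLocCochain x j (i + 1) (d x i c) := by
  funext t
  simp [locD_apply, toLocCochain_apply, d_apply, res_res]

theorem contraction_d_zero (c : Cochain x 0) :
    contraction x j 0 (d x 0 c) = toLocCochain x j 0 c := by
  funext s
  have hs : s.1 = ∅ := Finset.card_eq_zero.1 s.2
  have h : j ∉ s.1 := by simp [hs]
  rw [contraction_of_notMem x j 0 _ s h
    ⟨insert j s.1, by rw [Finset.card_insert_of_notMem h, s.2]⟩ rfl, res_self, d_apply,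
    toLocCochain_apply, Fintype.sum_eq_single ⟨j, Finset.mem_insert_self j s.1⟩,
    neg_one_pow_mul_self]
  · exact res_congr x c (Subtype.ext (Finset.erase_insert h)) _ _
  · rintro ⟨k, hk⟩ hkj
    have hk' := (Finset.mem_insert.1 hk).resolve_right (by simp [hs])
    exact absurd (Subtype.ext hk') hkj

theorem locD_contraction_of_mem (i : ℕ) (c : Cochain x (i + 1)) (t) (hj : j ∈ t.1) :
    locD x j i (contraction x j i c) t = toLocCochain x j (i + 1) c t := by
  rw [locD_apply, toLocCochain_apply, Fintype.sum_eq_single ⟨j, hj⟩]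
  · rw [contraction_of_notMem x j i c (face t ⟨j, hj⟩) (Finset.notMem_erase j t.1) t
      (Finset.insert_erase hj).symm, map_mul, map_pow, map_neg, map_one, neg_one_pow_mul_self,
      res_res]
  · rintro k hk
    rw [contraction_of_mem, map_zero, mul_zero]
    exact Finset.mem_erase.2 ⟨fun h => hk (Subtype.ext h.symm), hj⟩

theorem locD_contraction_of_notMem (i : ℕ) (c : Cochain x (i + 1)) (t) (hj : j ∉ t.1) :
    locD x j i (contraction x j i c) t + contraction x j (i + 1) (d x (i + 1) c) t =
      toLocCochain x j (i + 1) c t := by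
  obtain ⟨T, hT⟩ : ∃ T : {s : Finset (Fin n) // s.card = i + 1 + 1}, T.1 = insert j t.1 :=
    ⟨⟨insert j t.1, by rw [Finset.card_insert_of_notMem hj, t.2]⟩, rfl⟩
  have hjT : j ∈ T.1 := by simp [hT]
  have hTj : T.1.erase j = t.1 := by rw [hT, Finset.erase_insert hj]
  rw [contraction_of_notMem x j _ _ t hj T hT, d_apply, locD_apply, toLocCochain_apply, map_sum,
    Fintype.sum_eq_add_sum_subtype_ne _ (⟨j, hjT⟩ : T.1), mul_add, map_mul, map_pow, map_neg,
    map_one, neg_one_pow_mul_self, res_res, add_left_comm,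
    res_congr x c (Subtype.ext hTj : face T ⟨j, hjT⟩ = t) _ (Finset.subset_insert j t.1)]
  -- The term that removes `j` is the localization of `c t`. The others, indexed by `k ∈ t`, cancel
  -- against the terms of `locD`: whichever of `j`, `k` is smaller, exactly one of the two positions
  -- drops by one.
  convert add_zero _ using 2
  let e : {k : T.1 // k ≠ ⟨j, hjT⟩} ≃ t.1 :=
    { toFun := fun k => ⟨k.1.1, hTj.le (Finset.mem_erase.2 ⟨fun h => k.2 (Subtype.ext h), k.1.2⟩)⟩
      invFun := fun k => ⟨⟨k.1, (Finset.mem_erase.1 (hTj.ge k.2)).2⟩, fun h =>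
        (Finset.mem_erase.1 (hTj.ge k.2)).1 (congrArg Subtype.val h)⟩
      left_inv := fun _ => rfl
      right_inv := fun _ => rfl }
  rw [← Equiv.sum_comp e.symm, Finset.mul_sum, ← Finset.sum_add_distrib]
  refine Finset.sum_eq_zero fun k _ => ?_
  obtain ⟨hkj, hkT⟩ := Finset.mem_erase.1 (hTj.ge k.2)
  have hface : (face T ⟨k.1, hkT⟩).1 = insert j (face t k).1 := by
    change T.1.erase k.1 = insert j (t.1.erase k.1)
    rw [hT, Finset.erase_insert_of_ne hkj.symm]
  rw [contraction_of_notMem x j i c (face t k) (fun h => hj (face_subset t k h))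
    (face T ⟨k.1, hkT⟩) hface]
  have h1 : pos (face T ⟨k.1, hkT⟩).1 j + _ = _ := pos_erase (k := j) hkT
  have h2 : pos (T.1.erase j) k.1 + _ = _ := pos_erase (k := k.1) hjT
  rw [hTj] at h2
  change _ + (-1) ^ pos T.1 j * res x _ ((-1) ^ pos T.1 k.1 * res x _ (c (face T ⟨k.1, hkT⟩))) = 0
  rw [map_mul, map_mul, map_pow, map_pow, map_neg, map_neg, map_one, map_one, res_res, res_res,
    ← mul_assoc, ← mul_assoc, ← add_mul, ← pow_add, ← pow_add]
  convert zero_mul _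
  rcases lt_or_gt_of_ne hkj with h | h
  · rw [if_pos h] at h1
    rw [if_neg h.not_gt] at h2
    rw [← h1, ← h2]
    ring
  · rw [if_neg h.not_gt] at h1
    rw [if_pos h] at h2
    rw [← h1, ← h2]
    ring

/-- The homotopy goes from unlocalized to localized cochains and bounds the localization map itself.
This suffices to kill cocycles up to a power of `x j`. -/
theorem locD_contraction (i : ℕ) (c : Cochain x (i + 1)) :
    locD x j i (contraction x j i c) + contraction x j (i + 1) (d x (i + 1) c) =
      toLocCochain x j (i + 1) c := by
  funext t
  by_cases hj : j ∈ t.1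
  · rw [Pi.add_apply, contraction_of_mem x j _ _ t hj, add_zero, locD_contraction_of_mem x j i c t hj]
  · exact locD_contraction_of_notMem x j i c t hj

/-- Inverting `Q` amounts to inverting `P` and `x j`, whether or not `j ∈ s`: `Q ∣ x j * P` turns
denominators `Q ^ k` into `(x j * P) ^ k`, and `x j ∣ Q` makes `x j` invertible. -/
theorem isLocalizedModule_resLin (s : Finset (Fin n)) :
    IsLocalizedModule (Submonoid.powers (x j)) (resLin x (Finset.subset_insert j s)) := by
  set P := ∏ k ∈ s, x k
  set Q := ∏ k ∈ insert j s, x k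
  have hPQ : Q ∣ x j * P := by
    by_cases h : j ∈ s
    · have : Q = P := by simp only [Q, P, Finset.insert_eq_of_mem h]
      rw [this]
      exact dvd_mul_left _ _
    · have : Q = x j * P := Finset.prod_insert h
      rw [this]
  have hyQ : x j ∣ Q := Finset.dvd_prod_of_mem x (Finset.mem_insert_self j s)
  have hy : IsUnit (algebraMap R (Localization.Away Q) (x j)) :=
    isUnit_of_dvd_unit (map_dvd _ hyQ) (IsLocalization.Away.algebraMap_isUnit Q)
  obtain ⟨u, hu⟩ := (IsLocalization.Away.algebraMap_isUnit (S := Localization.Away P) P).exists_right_inv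
  obtain ⟨v, hv⟩ := hPQ
  have hres (r : R) : res x (Finset.subset_insert j s) (algebraMap R _ r) = algebraMap R _ r := by
    simp [res]
  refine IsLocalizedModule.Away.mk_of_addCommGroup ?_ ?_ ?_
  · convert hy.map (Algebra.lmul R (Localization.Away Q))
    exact LinearMap.ext fun z => Algebra.smul_def (x j) z
  · intro z
    obtain ⟨k, a, hk⟩ := IsLocalization.Away.surj Q z
    refine ⟨k, algebraMap R _ (a * v ^ k) * u ^ k, ?_⟩
    have hu' := congrArg (res x (Finset.subset_insert j s)) hu
    rw [map_mul, map_one, hres] at hu'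
    have hv' := congrArg (algebraMap R (Localization.Away Q)) hv
    rw [map_mul, map_mul] at hv'
    rw [resLin_apply, map_mul, map_pow, hres, map_mul, ← hk, Algebra.smul_def, map_pow, map_pow]
    calc _ = algebraMap R (Localization.Away Q) (x j) ^ k * z * 1 ^ k := by ring
      _ = (algebraMap R (Localization.Away Q) (x j) * algebraMap R (Localization.Away Q) P) ^ k * z
            * res x (Finset.subset_insert j s) u ^ k := by rw [← hu']; ring
      _ = _ := by rw [hv']; ring
  · intro z hz
    obtain ⟨k, a, hk⟩ := IsLocalization.Away.surj P z
    have ha : algebraMap R (Localization.Away Q) a = 0 := by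
      rw [← hres, ← hk, map_mul, ← resLin_apply, hz, zero_mul]
    obtain ⟨l, hl⟩ := IsLocalization.Away.exists_of_eq (S := Localization.Away Q) Q
      (ha.trans (map_zero _).symm)
    refine ⟨l, ?_⟩
    have hl' : (x j * P) ^ l * a = 0 := by
      rw [hv, mul_pow, mul_right_comm, hl, mul_zero, zero_mul]
    have hl'' := congrArg (algebraMap R (Localization.Away P)) hl'
    rw [map_mul, ← hk, map_pow, map_mul, map_zero] at hl''
    rw [Algebra.smul_def, map_pow]
    calc _ = algebraMap R (Localization.Away P) (x j) ^ l * z * 1 ^ (l + k) := by ring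
      _ = (algebraMap R (Localization.Away P) (x j) * algebraMap R (Localization.Away P) P) ^ l *
            (z * algebraMap R (Localization.Away P) P ^ k) * u ^ (l + k) := by rw [← hu]; ring
      _ = 0 := by rw [hl'', zero_mul]

theorem isLocalizedModule_toLocCochain (i : ℕ) :
    IsLocalizedModule (Submonoid.powers (x j)) (toLocCochain x j i) := by
  have (s : {s : Finset (Fin n) // s.card = i}) := isLocalizedModule_resLin x j s.1
  exact IsLocalizedModule.pi (Submonoid.powers (x j)) _

variable {x j}

theorem exists_pow_smul_mem_coboundariesCoeff (N : Type u) [AddCommGroup N] [Module R N] {i : ℕ}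
    (c : Cochain x i ⊗[R] N) (hc : c ∈ cocyclesCoeff (d x) N i) (j : Fin n) :
    ∃ k, x j ^ k • c ∈ coboundariesCoeff (d x) N i := by
  have hloc (i : ℕ) : IsLocalizedModule (Submonoid.powers (x j))
      ((toLocCochain x j i).rTensor N) := by
    have := isLocalizedModule_toLocCochain x j i
    exact IsLocalizedModule.rTensor (R := R) (A := R) (Submonoid.powers (x j)) (toLocCochain x j i)
  have hker (b : Cochain x i ⊗[R] N) (hb : (toLocCochain x j i).rTensor N b = 0) :
      ∃ k, x j ^ k • b = 0 := by
    obtain ⟨⟨_, k, rfl⟩, hk⟩ := (IsLocalizedModule.eq_zero_iff (Submonoid.powers (x j)) _).1 hb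
    exact ⟨k, hk⟩
  have hc' : (d x i).rTensor N c = 0 := hc
  cases i with
  | zero =>
    obtain ⟨k, hk⟩ := hker c (by
      rw [← show (contraction x j 0).comp (d x 0) = toLocCochain x j 0 from
        LinearMap.ext (contraction_d_zero x j), LinearMap.rTensor_comp, LinearMap.comp_apply, hc',
        map_zero])
    exact ⟨k, hk⟩
  | succ i =>
    have h1 : (toLocCochain x j (i + 1)).rTensor N c =
        (locD x j i).rTensor N ((contraction x j i).rTensor N c) := by
      rw [← show (locD x j i).comp (contraction x j i) + (contraction x j (i + 1)).comp
        (d x (i + 1)) = toLocCochain x j (i + 1) from LinearMap.ext (locD_contraction x j i),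
        LinearMap.rTensor_add, LinearMap.rTensor_comp, LinearMap.rTensor_comp, LinearMap.add_apply,
        LinearMap.comp_apply, LinearMap.comp_apply, hc', map_zero, add_zero]
    -- One power of `x j` clears the denominators of the contracted cocycle. A second one, `l`
    -- below, is needed because the resulting equation holds only after localization.
    obtain ⟨⟨b, ⟨_, k, rfl⟩⟩, hb⟩ := IsLocalizedModule.surj (Submonoid.powers (x j)) ((toLocCochain x j i).rTensor N) ((contraction x j i).rTensor N c)
    have hb' : x j ^ k • (contraction x j i).rTensor N c = (toLocCochain x j i).rTensor N b := hb
    obtain ⟨l, hl⟩ := hker (x j ^ k • c - (d x i).rTensor N b) (by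
      rw [map_sub, map_smul, h1, ← map_smul, hb', sub_eq_zero, ← LinearMap.comp_apply,
        ← LinearMap.comp_apply, ← LinearMap.rTensor_comp, ← LinearMap.rTensor_comp,
        show (locD x j i).comp (toLocCochain x j i) = (toLocCochain x j (i + 1)).comp (d x i) from
          LinearMap.ext (locD_toLocCochain x j i)])
    refine ⟨l + k, x j ^ l • b, ?_⟩
    rw [smul_sub, sub_eq_zero, ← mul_smul, ← pow_add] at hl
    rw [map_smul, hl]

end Contraction

/-! ### Application to local cohomology -/

section Cofinite

variable {R : Type u} [CommRing R] {n : ℕ} (x : Fin n → R)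

instance flat_cochain (i : ℕ) : Module.Flat R (Cochain x i) := by
  have (s : {s : Finset (Fin n) // s.card = i}) : Module.Flat R (Loc x s.1) :=
    IsLocalization.flat _ (Submonoid.powers (∏ j ∈ s.1, x j))
  exact Module.Flat.of_linearEquiv (DFinsupp.linearEquivFunOnFintype (R := R)
    (M := fun s : {s : Finset (Fin n) // s.card = i} => Loc x s.1)).symm

variable [IsLocalRing R] [IsNoetherianRing R]
  {K : Type v} [Field K] [Algebra K R] {x}

theorem isMTorsion_cohCoeff (hx : maximalIdeal R ≤ (Ideal.span (Set.range x)).radical)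
    (N : Type u) [AddCommGroup N] [Module R N] (i : ℕ) : IsMTorsion R (cohCoeff (d x) N i) := by
  intro z
  obtain ⟨c, rfl⟩ := Submodule.Quotient.mk_surjective _ z
  let z : cohCoeff (d x) N i := Submodule.Quotient.mk c
  have h : maximalIdeal R ≤ (Ideal.torsionOf R _ z).radical := by
    refine hx.trans (Ideal.radical_le_radical_iff.2 (Ideal.span_le.2 ?_))
    rintro _ ⟨j, rfl⟩
    obtain ⟨k, hk⟩ := exists_pow_smul_mem_coboundariesCoeff N c.1 c.2 j
    exact ⟨k, (Ideal.mem_torsionOf_iff _ _).2 ((cohCoeff_mk_eq_zero (d x) (x j ^ k • c)).2 hk)⟩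
  obtain ⟨k, hk⟩ := Ideal.exists_pow_le_of_le_radical_of_fg h (IsNoetherian.noetherian _)
  exact ⟨k, fun r hr => (Ideal.mem_torsionOf_iff _ _).1 (hk hr)⟩

/-- In degree 0 only the empty product occurs, so the module is a quotient of the residue field. In
positive degree some `x j` is both invertible and zero on it. -/
theorem isCofinite_cochain_residue (hK : Function.Surjective ((residue R).comp (algebraMap K R)))
    (hx : ∀ j, x j ∈ maximalIdeal R) (i : ℕ) :
    IsCofinite K R (Cochain x i ⊗[R] (R ⧸ maximalIdeal R)) := by
  cases i with
  | zero =>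
    have hsurj : Function.Surjective (LinearMap.toSpanSingleton R (Cochain x 0) 1) := by
      intro c
      have h0 (s : {s : Finset (Fin n) // s.card = 0}) : ∃ r : R, algebraMap R (Loc x s.1) r = c s := by
        have hs : ∏ j ∈ s.1, x j = 1 := by rw [Finset.card_eq_zero.1 s.2, Finset.prod_empty]
        obtain ⟨k, a, hk⟩ := IsLocalization.Away.surj (∏ j ∈ s.1, x j) (c s)
        exact ⟨a, by rw [← hk]; simp [hs]⟩
      obtain ⟨r, hr⟩ := h0 ⟨∅, rfl⟩
      refine ⟨r, funext fun s => ?_⟩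
      obtain rfl : s = ⟨∅, rfl⟩ := Subtype.ext (Finset.card_eq_zero.1 s.2)
      rw [← hr, Algebra.algebraMap_eq_smul_one]
      rfl
    refine (isCofinite_residue hK).of_surjective
      (((LinearMap.toSpanSingleton R (Cochain x 0) 1).rTensor _).comp
        (TensorProduct.lid R _).symm.toLinearMap) ?_
    exact (LinearMap.rTensor_surjective _ hsurj).comp (TensorProduct.lid R _).symm.surjective
  | succ i =>
    have : Subsingleton (Cochain x (i + 1) ⊗[R] (R ⧸ maximalIdeal R)) := by
      refine subsingleton_of_forall_eq 0 fun z => ?_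
      induction z using TensorProduct.induction_on with
      | zero => rfl
      | add z w h1 h2 => rw [h1, h2, add_zero]
      | tmul c a =>
        classical
        rw [← Finset.univ_sum_single c, TensorProduct.sum_tmul]
        refine Finset.sum_eq_zero fun s _ => ?_
        obtain ⟨j, hj⟩ : s.1.Nonempty := Finset.card_pos.1 (by rw [s.2]; exact Nat.succ_pos i)
        have hu : IsUnit (algebraMap R (Loc x s.1) (x j)) :=
          isUnit_of_dvd_unit (map_dvd _ (Finset.dvd_prod_of_mem x hj))
            (IsLocalization.Away.algebraMap_isUnit (∏ j ∈ s.1, x j))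
        obtain ⟨w, hw⟩ := hu.dvd (a := c s)
        rw [hw, ← Algebra.smul_def, Pi.single_smul, TensorProduct.smul_tmul]
        obtain ⟨b, rfl⟩ := Submodule.Quotient.mk_surjective _ a
        rw [← Submodule.Quotient.mk_smul, smul_eq_mul,
          (Submodule.Quotient.mk_eq_zero _).2 (Ideal.mul_mem_right b _ (hx j)),
          TensorProduct.tmul_zero]
    exact isCofinite_of_subsingleton

theorem rid_rTensor {A B : Type*} [AddCommGroup A] [Module R A] [AddCommGroup B] [Module R B]
    (g : A →ₗ[R] B) (c : A ⊗[R] R) :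
    TensorProduct.rid R B (g.rTensor R c) = g (TensorProduct.rid R A c) := by
  induction c using TensorProduct.induction_on with
  | zero => simp
  | add a b h1 h2 => simp only [map_add, h1, h2]
  | tmul a r => simp

theorem rid_mem_coboundaries {i : ℕ} {c : Cochain x i ⊗[R] R}
    (hc : c ∈ coboundariesCoeff (d x) R i) :
    TensorProduct.rid R (Cochain x i) c ∈ coboundaries x i := by
  cases i with
  | zero =>
    have : c = 0 := hc
    rw [this, map_zero]
    exact zero_mem _
  | succ i =>
    obtain ⟨b, rfl⟩ := hc
    exact ⟨_, (rid_rTensor _ _).symm⟩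

/-- The comparison map on cocycles with coefficients in the ring. -/
def cocyclesCoeffToCocycles (i : ℕ) : cocyclesCoeff (d x) R i →ₗ[R] cocycles x i :=
  (TensorProduct.rid R (Cochain x i)).toLinearMap.restrict fun c hc => by
    change d x i (TensorProduct.rid R (Cochain x i) c) = 0
    rw [← rid_rTensor, show (d x i).rTensor R c = 0 from hc, map_zero]

/-- The comparison map on cohomology with coefficients in the ring. -/
def cohCoeffToH (i : ℕ) : cohCoeff (d x) R i →ₗ[R] H x i :=
  Submodule.mapQ _ ((coboundaries x i).submoduleOf (cocycles x i)) (cocyclesCoeffToCocycles i)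
    fun _ hc => rid_mem_coboundaries hc

/-- Surjectivity is enough, since torsion and cofiniteness pass to quotients. -/
theorem cohCoeffToH_surjective (i : ℕ) : Function.Surjective (cohCoeffToH (x := x) i) := by
  intro z
  obtain ⟨c, rfl⟩ := Submodule.Quotient.mk_surjective _ z
  have hc : (TensorProduct.rid R (Cochain x i)).symm c.1 ∈ cocyclesCoeff (d x) R i := by
    apply (TensorProduct.rid R (Cochain x (i + 1))).injective
    rw [rid_rTensor, LinearEquiv.apply_symm_apply, map_zero]
    exact c.2
  refine ⟨Submodule.Quotient.mk ⟨_, hc⟩, ?_⟩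
  refine congrArg Submodule.Quotient.mk (Subtype.ext ?_)
  exact (TensorProduct.rid R (Cochain x i)).apply_symm_apply c.1

theorem isMTorsion_H (hx : maximalIdeal R ≤ (Ideal.span (Set.range x)).radical) (i : ℕ) :
    IsMTorsion R (H x i) := by
  intro z
  obtain ⟨w, rfl⟩ := cohCoeffToH_surjective i z
  obtain ⟨k, hk⟩ := isMTorsion_cohCoeff hx R i w
  exact ⟨k, fun r hr => by rw [← map_smul, hk r hr, map_zero]⟩

theorem isCofinite_H [IsAdicComplete (maximalIdeal R) R]
    (hK : Function.Surjective ((residue R).comp (algebraMap K R)))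
    (hx : (Ideal.span (Set.range x)).radical = maximalIdeal R) (i : ℕ) :
    IsCofinite K R (H x i) := by
  refine (isCofinite_cohCoeff (d x) (d_d x) (isCofinite_cochain_residue hK fun j => ?_)
    (fun N _ _ i => isMTorsion_cohCoeff hx.ge N i) i R).of_surjective _
    (cohCoeffToH_surjective (x := x) i)
  rw [← hx]
  exact Ideal.le_radical (Ideal.subset_span ⟨j, rfl⟩)

end Cofinite

/-! ### Functoriality, and the comparison of stable parts -/

section Functoriality

variable {R S T : Type u} [CommRing R] [CommRing S] [CommRing T] {n : ℕ}

theorem awayMap_self {φ : R →+* R} (hφ : ∀ r, φ r = r) {a : R} (h : ∃ k : ℕ, φ a ∣ a ^ k)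
    (z : Localization.Away a) : awayMap φ h z = z := by
  have : awayMap φ h = RingHom.id _ :=
    IsLocalization.ringHom_ext (Submonoid.powers a) (RingHom.ext fun r => by simp [hφ])
  rw [this, RingHom.id_apply]

theorem mapH_self {φ : R →+* R} (hφ : ∀ r, φ r = r) {x : Fin n → R}
    (h : ∃ k : ℕ, ∀ j, φ (x j) ∣ x j ^ k) (i : ℕ) (z : H x i) : mapH φ h i z = z := by
  obtain ⟨c, rfl⟩ := Submodule.Quotient.mk_surjective _ z
  refine congrArg Submodule.Quotient.mk (Subtype.ext (funext fun s => ?_))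
  exact awayMap_self hφ (prod_map_dvd φ h s.1) _

/-- Relations between `F`, `G`, `τ` and `ρ` thereby reduce to identities of ring homomorphisms. -/
theorem mapH_mapH (φ : R →+* S) (ψ : S →+* T) (χ : R →+* T) (hχ : ∀ r, ψ (φ r) = χ r)
    {x : Fin n → R} {y : Fin n → S} {w : Fin n → T} (h : ∃ k : ℕ, ∀ j, φ (x j) ∣ y j ^ k)
    (h' : ∃ k : ℕ, ∀ j, ψ (y j) ∣ w j ^ k) (h'' : ∃ k : ℕ, ∀ j, χ (x j) ∣ w j ^ k) (i : ℕ)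
    (z : H x i) : mapH ψ h' i (mapH φ h i z) = mapH χ h'' i z := by
  obtain ⟨c, rfl⟩ := Submodule.Quotient.mk_surjective _ z
  refine congrArg Submodule.Quotient.mk (Subtype.ext (funext fun s => ?_))
  exact awayMap_awayMap φ ψ χ (prod_map_dvd φ h s.1) (prod_map_dvd ψ h' s.1)
    (prod_map_dvd χ h'' s.1) hχ _

theorem iterate_frobeniusAction (p : ℕ) [ExpChar R p] (x : Fin n → R) (i e : ℕ) (z : H x i) :
    (frobeniusAction p x i)^[e] z =
      mapH (iterateFrobenius R p e) ⟨p ^ e, fun j => by rw [iterateFrobenius_def]⟩ i z := by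
  induction e with
  | zero => exact (mapH_self (fun r => by simp) _ i z).symm
  | succ e ih =>
    rw [Function.iterate_succ_apply', ih]
    exact mapH_mapH _ _ _ (fun r => by
      rw [frobenius_def, iterateFrobenius_def, iterateFrobenius_def, ← pow_mul, pow_succ]) _ _ _ i z

end Functoriality

/-! ### Stable preimages under an additive endomorphism -/

section Stable

variable {A B : Type*} [AddCommGroup A] [AddCommGroup B]

/-- For preimages `w k` of `y` under `G^(e + e₀ + k)`, the difference `G^k (w k) - w 0` is
nilpotent, hence killed by `G^e₀`. So `G^e₀ (w 0)` equals `G^k (G^e₀ (w k))` for every `k` and is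
stable. -/
theorem exists_iterate_preimage_stable (G : B →+ B) (e₀ : ℕ)
    (hG : ∀ z, (∃ e, G^[e] z = 0) → G^[e₀] z = 0) (e : ℕ) {y : B}
    (hy : y ∈ ⋂ k : ℕ, Set.range G^[k]) :
    ∃ u ∈ ⋂ k : ℕ, Set.range G^[k], G^[e] u = y := by
  have hw (k : ℕ) : ∃ w, G^[e + (e₀ + k)] w = y := Set.mem_iInter.1 hy _
  choose w hw using hw
  have hu (k : ℕ) : G^[e₀ + k] (w k) = G^[e₀] (w 0) := by
    rw [Function.iterate_add_apply, ← sub_eq_zero, ← iterate_map_sub]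
    refine hG _ ⟨e + e₀, ?_⟩
    rw [iterate_map_sub, ← Function.iterate_add_apply, add_assoc, hw, sub_eq_zero]
    exact (hw 0).symm
  refine ⟨G^[e₀] (w 0), Set.mem_iInter.2 fun k => ⟨G^[e₀] (w k), ?_⟩, ?_⟩
  · rw [← Function.iterate_add_apply, add_comm, hu]
  · rw [← Function.iterate_add_apply]
    exact hw 0

end Stable

/-! ### Comparison of the stable parts -/

section Main

variable {K : Type v} {R : Type u} [Field K] [CommRing R] [IsNoetherianRing R] [IsLocalRing R]
  [IsAdicComplete (maximalIdeal R) R] [Algebra K R] (p : ℕ) [Fact p.Prime] [ExpChar K p]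
  [PerfectRing K p] [ExpChar R p] [ExpChar (R ⧸ nilradical R) p]

theorem exists_pow_eq_zero_of_mem_nilradical :
    ∃ e : ℕ, ∀ r ∈ nilradical R, r ^ p ^ e = 0 := by
  obtain ⟨k, hk⟩ := IsNoetherianRing.isNilpotent_nilradical R
  refine ⟨k, fun r hr => pow_eq_zero_of_le (Nat.lt_pow_self (Fact.out : p.Prime).one_lt).le ?_⟩
  have := Ideal.pow_mem_pow hr k
  rwa [hk] at this

theorem exists_stablePart_equiv
    (hK : Function.Surjective ((residue R).comp (algebraMap K R))) {n : ℕ} (x : Fin n → R)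
    (hx : (Ideal.span (Set.range x)).radical = maximalIdeal R) (i : ℕ) :
    ∃ f : stablePart K p (frobeniusAction p x i) ≃ₗ[K]
        stablePart K p (frobeniusAction p (fun j => Ideal.Quotient.mk (nilradical R) (x j)) i),
      ∀ μ, (f μ : H (fun j => Ideal.Quotient.mk (nilradical R) (x j)) i) =
        naturalMap (Ideal.Quotient.mk (nilradical R)) x i μ := by
  set q := Ideal.Quotient.mk (nilradical R)
  set F := frobeniusAction p x i
  set G := frobeniusAction p (fun j => q (x j)) i
  set τ := naturalMap q x i
  obtain ⟨e, he⟩ := exists_pow_eq_zero_of_mem_nilradical (R := R) p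
  let ψ : R ⧸ nilradical R →+* R := Ideal.Quotient.lift (nilradical R) (iterateFrobenius R p e)
    fun r hr => by rw [iterateFrobenius_def, he r hr]
  have hψ (r : R) : ψ (q r) = r ^ p ^ e := by
    rw [← iterateFrobenius_def]
    exact Ideal.Quotient.lift_mk _ _ _
  let ρ := mapH ψ (x := fun j => q (x j)) (y := x) ⟨p ^ e, fun j => by rw [hψ]⟩ i
  have hρτ (z : H x i) : ρ (τ z) = F^[e] z := by
    rw [iterate_frobeniusAction]
    exact mapH_mapH q ψ _ (fun r => by rw [hψ, iterateFrobenius_def]) _ _ _ i z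
  have hqψ (r : R ⧸ nilradical R) : q (ψ r) = iterateFrobenius _ p e r := by
    obtain ⟨r, rfl⟩ := Ideal.Quotient.mk_surjective r
    rw [hψ, iterateFrobenius_def, map_pow]
  have hτρ (z : H (fun j => q (x j)) i) : τ (ρ z) = G^[e] z := by
    rw [iterate_frobeniusAction]
    exact mapH_mapH ψ q _ hqψ _ _ _ i z
  have hτF : Function.Semiconj τ F G := fun z => by
    have h : ∃ k : ℕ, ∀ j, q.comp (frobenius R p) (x j) ∣ q (x j) ^ k :=
      ⟨p, fun j => by simp [frobenius_def]⟩
    exact (mapH_mapH (frobenius R p) q (q.comp (frobenius R p)) (fun _ => rfl) _ _ h i z).trans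
      (mapH_mapH q (frobenius _ p) (q.comp (frobenius R p))
        (fun r => by simp [frobenius_def]) _ _ h i z).symm
  have hρG : Function.Semiconj ρ G F := fun z => by
    have h : ∃ k : ℕ, ∀ j, (frobenius R p).comp ψ (q (x j)) ∣ x j ^ k :=
      ⟨p ^ e * p, fun j => by simp [frobenius_def, hψ, pow_mul]⟩
    exact (mapH_mapH (frobenius _ p) ψ ((frobenius R p).comp ψ)
      (fun r => by simp [frobenius_def]) _ _ h i z).trans
      (mapH_mapH ψ (frobenius R p) ((frobenius R p).comp ψ) (fun _ => rfl) _ _ h i z).symm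
  obtain ⟨e₀, he₀⟩ := exists_iterate_eq_zero p F hK (isMTorsion_H hx.ge i) (isCofinite_H hK hx i)
  -- The bound for `G` comes from the one for `F` by `G^(e₀ + e) = G^e₀ τ ρ = τ F^e₀ ρ`.
  have he₁ (z : H (fun j => q (x j)) i) (hz : ∃ e', G^[e'] z = 0) : G^[e + e₀] z = 0 := by
    obtain ⟨e', hz⟩ := hz
    have h1 : F^[e₀] (ρ z) = 0 := he₀ _ ⟨e', by
      rw [← (hρG.iterate_right e').eq, hz, map_zero]⟩
    rw [add_comm, Function.iterate_add_apply, ← hτρ, ← (hτF.iterate_right e₀).eq, h1, map_zero]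
  have hmem (μ : H x i) (hμ : μ ∈ stablePart K p F) : τ μ ∈ stablePart K p G := by
    refine Set.mem_iInter.2 fun k => ?_
    obtain ⟨ν, rfl⟩ := Set.mem_iInter.1 hμ k
    exact ⟨τ ν, ((hτF.iterate_right k).eq ν).symm⟩
  let f : stablePart K p F →ₗ[K] stablePart K p G :=
    { toFun := fun μ => ⟨τ μ, hmem μ μ.2⟩
      map_add' := fun μ ν => Subtype.ext (map_add τ _ _)
      map_smul' := fun k μ => Subtype.ext (τ.map_smulₛₗ (algebraMap K R k) μ.1) }
  refine ⟨LinearEquiv.ofBijective f ⟨?_, ?_⟩, fun μ => rfl⟩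
  · rw [← LinearMap.ker_eq_bot, LinearMap.ker_eq_bot']
    rintro ⟨μ, hμ⟩ h
    have h0 : τ μ = 0 := congrArg Subtype.val h
    -- Stability gives `μ = F^e₀ ν`. Applying `ρ` to `τ μ = 0` makes `ν` nilpotent, so already `F^e₀
    -- ν = 0`.
    obtain ⟨ν, rfl⟩ := Set.mem_iInter.1 hμ e₀
    refine Subtype.ext (he₀ ν ⟨e + e₀, ?_⟩)
    rw [Function.iterate_add_apply, ← hρτ, h0, map_zero]
  · rintro ⟨y, hy⟩
    obtain ⟨u, hu, huy⟩ := exists_iterate_preimage_stable G.toAddMonoidHom (e + e₀) he₁ e hy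
    refine ⟨⟨ρ u, Set.mem_iInter.2 fun k => ?_⟩, Subtype.ext ((hτρ u).trans huy)⟩
    obtain ⟨w, rfl⟩ := Set.mem_iInter.1 hu k
    exact ⟨ρ w, ((hρG.iterate_right k).eq w).symm⟩

end Main

end CechLC

end

theorem proposition6p5 {K : Type v} {R : Type u} (p : ℕ) [Fact p.Prime]
    [Field K] [IsAlgClosed K] [CharP K p]
    [CommRing R] [IsNoetherianRing R] [IsLocalRing R]
    [IsAdicComplete (IsLocalRing.maximalIdeal R) R] [CharP R p]
    [Algebra K R]
    (hK : Function.Bijective ((IsLocalRing.residue R).comp (algebraMap K R)))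
    {n : ℕ} (x : Fin n → R)
    (hx : (Ideal.span (Set.range x)).radical = IsLocalRing.maximalIdeal R) (i : ℕ) :
    ∃ f : CechLC.stablePart K p (CechLC.frobeniusAction p x i) ≃ₗ[K]
        CechLC.stablePart K p (CechLC.frobeniusAction p
          (fun j => Ideal.Quotient.mk (nilradical R) (x j)) i),
      ∀ μ, (f μ : CechLC.H (fun j => Ideal.Quotient.mk (nilradical R) (x j)) i) =
        CechLC.naturalMap (Ideal.Quotient.mk (nilradical R)) x i μ :=
  CechLC.exists_stablePart_equiv p hK.2 x hx i
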